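/- Proposition (pseudo-manifolds are minimal to linearity). Let $K$ be a field, let $n$ and $d$ be positive integers, and let $\mathcal C$ be a non-empty $d$-uniform clutter on $[n]=\{1,\dots,n\}$, i.e. a non-empty set of $d$-element subsets of $[n]$, called circuits. Suppose that $\mathcal C$ is a pseudo-manifold: any two circuits $F,G\in\mathcal C$ are joined by a chain of circuits $F=F_0,\dots,F_s=G$ in $\mathcal C$ with $|F_i\cap F_{i+1}|=d-1$ for all $i<s$, and every $(d-1)$-subset of $[n]$ that is contained in some circuit is contained in exactly two circuits. Suppose also that $\mathcal C$ is not the boundary of a $d$-dimensional simplex, i.e. there is no $(d+1)$-subset $W\subseteq[n]$ such that $\mathcal C$ is the set of all $d$-subsets of $W$. (i) If $\mathcal C$ is oriented, then $\mathcal C$ is minimal to $d$-linearity over $K$. (ii) If $\mathcal C$ is non-oriented, then $\mathcal C$ is minimal to $d$-linearity over $K$ if and only if $\operatorname{char} K=2$. Here $\mathcal C$ is called oriented if its circuits, regarded as $(d-1)$-dimensional simplices, can be oriented so that any two different circuits that share a $(d-1)$-subset induce opposite orientations on it, and non-oriented otherwise. For a $d$-uniform clutter $\mathcal D$ on $[n]$,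 the circuit ideal $I(\bar{\mathcal D})\subseteq S=K[x_1,\dots,x_n]$ is generated by the monomials $\prod_{i\in T}x_i$, where $T$ runs over the $d$-subsets of $[n]$ with $T\notin\mathcal D$. A non-zero homogeneous ideal $I\subseteq S$ has a $d$-linear resolution if its Castelnuovo–Mumford regularity $\sup\{j-i:\beta_{i,j}(I)\neq 0\}$ and its initial degree $\min\{i: I_i\ne0\}$ are both equal to $d$, where $\beta_{i,j}(I)$ is the number of summands $S(-j)$ in the $i$-th module ($i\ge 0$) of the minimal graded free resolution of $I$; the zero ideal is regarded as having a $d$-linear resolution. The clutter $\mathcal C$ is minimal to $d$-linearity over $K$ if $I(\bar{\mathcal C})$ does not have a $d$-linear resolution, $I(\bar{\mathcal C'})$ has a $d$-linear resolution for every proper subset $\mathcal C'\subsetneq\mathcal C$, and the clique complex $\{V\subseteq[n]:\text{every } d\text{-subset of } V \text{ belongs to } \mathcal C\}$ has dimension $d-1$, i.e. its largest faces have exactly $d$ elements. -/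

import Mathlib

open MvPolynomial

/-! ### Graded free resolutions over a standard graded polynomial ring -/

/-- A minimal graded free resolution `⋯ → F₁ → F₀ → I → 0` of an ideal `I` of the standard graded
polynomial ring `S = K[x_v : v ∈ σ]`, written with homogeneous bases:
`F_i = ⨁_a S(-shift i a)`, where `a` runs over `Fin (rank i)`. The map `F₀ → I` sends the `a`-th
basis vector to `aug a`, and `F_{i+1} → F_i` is multiplication by the matrix `diff i`. -/
structure MinimalGradedFreeResolution {K : Type*} [Field K] {σ : Type*}
    (I : Ideal (MvPolynomial σ K)) where
  /-- The rank of the free module `F_i`. -/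
  rank : ℕ → ℕ
  /-- The degrees of the basis vectors of `F_i`. -/
  shift : ∀ i, Fin (rank i) → ℕ
  /-- The images in `I` of the basis vectors of `F₀`. -/
  aug : Fin (rank 0) → MvPolynomial σ K
  /-- The matrix of the differential `F_{i+1} → F_i`. -/
  diff : ∀ i, Matrix (Fin (rank i)) (Fin (rank (i + 1))) (MvPolynomial σ K)
  /-- The map `F₀ → I` is homogeneous of degree `0`. -/
  aug_homogeneous : ∀ a, (aug a).IsHomogeneous (shift 0 a)
  /-- The differentials are homogeneous of degree `0`: the entry at `(a, b)` is homogeneous of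
  degree `shift (i + 1) b - shift i a`, and it is `0` if this number is negative. -/
  diff_homogeneous : ∀ i a b, ∀ m ∈ (diff i a b).support,
    m.degree + shift i a = shift (i + 1) b
  /-- `F₀ → I` is onto. -/
  range_aug : LinearMap.range (Fintype.linearCombination (MvPolynomial σ K) aug) = I
  /-- Exactness at `F₀`. -/
  exact_zero : LinearMap.range (diff 0).mulVecLin =
    LinearMap.ker (Fintype.linearCombination (MvPolynomial σ K) aug)
  /-- Exactness at `F_{i+1}`. -/
  exact_succ : ∀ i, LinearMap.range (diff (i + 1)).mulVecLin = LinearMap.ker (diff i).mulVecLin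
  /-- Minimality: the image of `F_{i+1}` lies in `𝔪 F_i`, where `𝔪` is generated by the
  variables. -/
  minimal : ∀ i a b, constantCoeff (diff i a b) = 0

/-- The graded Betti number `β_{i,j}`: the number of summands `S(-j)` of `F_i`. -/
def MinimalGradedFreeResolution.betti {K : Type*} [Field K] {σ : Type*}
    {I : Ideal (MvPolynomial σ K)} (F : MinimalGradedFreeResolution I) (i j : ℕ) : ℕ :=
  (Finset.univ.filter (fun a : Fin (F.rank i) => F.shift i a = j)).card

/-- The Castelnuovo–Mumford regularity `sup {j - i : β_{i,j}(I) ≠ 0}` of `I` is equal to `r`. -/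
def HasRegularity {K : Type*} [Field K] {σ : Type*} (I : Ideal (MvPolynomial σ K)) (r : ℤ) :
    Prop :=
  ∃ F : MinimalGradedFreeResolution I,
    IsLUB {s : ℤ | ∃ i j : ℕ, F.betti i j ≠ 0 ∧ s = (j : ℤ) - (i : ℤ)} r

/-- The initial degree `inf {i : I_i ≠ 0}` of `I` is equal to `d`. -/
def HasInitialDegree {K : Type*} [Field K] {σ : Type*} (I : Ideal (MvPolynomial σ K)) (d : ℕ) :
    Prop :=
  IsLeast {i : ℕ | ∃ f ∈ I, f ≠ 0 ∧ f.IsHomogeneous i} d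

/-- `I` has a `d`-linear resolution: its regularity and its initial degree are both equal to `d`.
By convention the zero ideal has a `d`-linear resolution. -/
def HasLinearResolution {K : Type*} [Field K] {σ : Type*} (I : Ideal (MvPolynomial σ K)) (d : ℕ) :
    Prop :=
  I = ⊥ ∨ (HasRegularity I (d : ℤ) ∧ HasInitialDegree I d)

/-! ### Clutters

A `d`-uniform clutter on the vertex set `Fin n` is a set `C` of `d`-element subsets of `Fin n`,
i.e. `C : Finset (Finset (Fin n))` with `(C : Set (Finset (Fin n))).Sized d`. Two different
`d`-element sets are never contained in one another, so the antichain condition is automatic. -/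

/-- The ideal `I(C)` generated by the monomials `∏_{v ∈ T} x_v`, `T ∈ C`. -/
noncomputable def clutterIdeal (K : Type*) [Field K] {n : ℕ} (C : Finset (Finset (Fin n))) :
    Ideal (MvPolynomial (Fin n) K) :=
  Ideal.span {f | ∃ T ∈ C, f = ∏ v ∈ T, X v}

/-- The complement of a `d`-uniform clutter: all `d`-subsets of the vertex set not in `C`. -/
def complementClutter {n : ℕ} (d : ℕ) (C : Finset (Finset (Fin n))) : Finset (Finset (Fin n)) :=
  Finset.powersetCard d Finset.univ \ C

/-- The circuit ideal of a `d`-uniform clutter. -/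
noncomputable def circuitIdeal (K : Type*) [Field K] {n : ℕ} (d : ℕ) (C : Finset (Finset (Fin n))) :
    Ideal (MvPolynomial (Fin n) K) :=
  clutterIdeal K (complementClutter d C)

/-- The clique complex: the set of cliques, i.e. of the vertex sets all of whose `d`-subsets are
circuits (it is closed under taking subsets, and contains the empty face if `d` is positive). -/
def cliqueComplex {n : ℕ} (d : ℕ) (C : Finset (Finset (Fin n))) : Finset (Finset (Fin n)) :=
  Finset.univ.filter (fun V => Finset.powersetCard d V ⊆ C)

/-- The dimension of a simplicial complex: the maximum of `|F| - 1` over its faces `F`. -/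
def complexDim {n : ℕ} (Δ : Finset (Finset (Fin n))) : ℤ :=
  ((Δ.sup Finset.card : ℕ) : ℤ) - 1

/-- The submaximal circuits of a `d`-uniform clutter: the `(d-1)`-sets contained in a circuit. -/
def submaximalCircuits {n : ℕ} (d : ℕ) (C : Finset (Finset (Fin n))) : Finset (Finset (Fin n)) :=
  Finset.univ.filter (fun e => e.card + 1 = d ∧ ∃ F ∈ C, e ⊆ F)

/-- The degree of a submaximal circuit: the number of circuits containing it. -/
def circuitDegree {n : ℕ} (C : Finset (Finset (Fin n))) (e : Finset (Fin n)) : ℕ :=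
  (C.filter (fun F => e ⊆ F)).card

/-- Any two circuits are joined by a chain of circuits, consecutive ones of which meet in
`d - 1` vertices. -/
def StronglyConnected {n : ℕ} (d : ℕ) (C : Finset (Finset (Fin n))) : Prop :=
  ∀ F ∈ C, ∀ G ∈ C,
    Relation.ReflTransGen (fun A B => A ∈ C ∧ B ∈ C ∧ (A ∩ B).card + 1 = d) F G

/-- A `d`-uniform clutter is a pseudo-manifold if it is strongly connected and every submaximal
circuit has degree `2`. -/
def IsPseudoManifold {n : ℕ} (d : ℕ) (C : Finset (Finset (Fin n))) : Prop :=
  (C : Set (Finset (Fin n))).Sized d ∧ StronglyConnected d C ∧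
    ∀ e ∈ submaximalCircuits d C, circuitDegree C e = 2

/-- The sign with which the face `e` occurs in the boundary of the simplex `insert v e`, both
oriented by the order of the vertices: `(-1)^k` if `v` is the `k`-th vertex of `insert v e`,
counted from `0`. -/
def incidenceSign {n : ℕ} (e : Finset (Fin n)) (v : Fin n) : ℤ :=
  (-1) ^ (e.filter (fun u => u < v)).card

/-- A pseudo-manifold is oriented (orientable) if its circuits can be oriented coherently: an
orientation of a circuit `F` is a sign `ε F`, relative to the orientation given by the order of the
vertices, and any two different circuits with a common submaximal circuit `e` have to induce
opposite orientations on `e`. -/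
def IsOrientable {n : ℕ} (C : Finset (Finset (Fin n))) : Prop :=
  ∃ ε : Finset (Fin n) → ℤˣ, ∀ (e : Finset (Fin n)) (v w : Fin n), v ∉ e → w ∉ e → v ≠ w →
    insert v e ∈ C → insert w e ∈ C →
      (ε (insert v e) : ℤ) * incidenceSign e v = -((ε (insert w e) : ℤ) * incidenceSign e w)

/-- The `d`-uniform clutter `C` is an obstruction to `d`-linearity over `K`: its circuit ideal has
no `d`-linear resolution, but the circuit ideal of each proper subclutter (on the same vertex set)
has one. -/
def IsObstructionToLinearity (K : Type*) [Field K] {n : ℕ} (d : ℕ)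
    (C : Finset (Finset (Fin n))) : Prop :=
  ¬ HasLinearResolution (circuitIdeal K d C) d ∧
    ∀ C' : Finset (Finset (Fin n)), C' ⊂ C → HasLinearResolution (circuitIdeal K d C') d

/-- The `d`-uniform clutter `C` is minimal to `d`-linearity over `K`: it is an obstruction to
`d`-linearity, and its clique complex has dimension `d - 1`. -/
def IsMinimalToLinearity (K : Type*) [Field K] {n : ℕ} (d : ℕ)
    (C : Finset (Finset (Fin n))) : Prop :=
  IsObstructionToLinearity K d C ∧ complexDim (cliqueComplex d C) = (d : ℤ) - 1

/-! ### Incidence signs -/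

/-! Linearity of the circuit ideal `I` is translated into the absence of simplicial cycles on the
clutter, and cycles on a pseudo-manifold are rigid.

For a graded ideal living in degrees at least `d`, a `d`-linear resolution exists if and only if the
Koszul homology with coefficients in the ideal vanishes above polynomial degree `d`. One direction
is dimension shifting along a given resolution (`HasLinearResolution.koszulAcyclicAbove`); the other
builds a resolution by repeatedly taking a basis of the lowest degree part and passing to syzygies
(`hasLinearResolution_of_koszulAcyclicAbove`).

A pseudo-manifold that is not the boundary of a simplex has no clique with `d + 1` vertices. Hence a
monomial lies outside `I` exactly when its support has fewer than `d` elements or is a circuit. The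
Koszul complex splits by multidegree, and only squarefree multidegrees can obstruct. There the
obstruction is the failure of the coboundary map onto functions on the circuits to be surjective,
which is dual to the existence of a non-zero cycle on `C` (`hasLinearResolution_circuitIdeal_iff`).

At a submaximal circuit the cycle condition relates exactly two values, so by strong connectivity a
cycle is constant up to sign. A proper subclutter therefore carries no cycle, while `C` itself
carries one exactly when it is orientable or the characteristic is 2. -/

lemma incidenceSign_mul_self {n : ℕ} (e : Finset (Fin n)) (v : Fin n) :
    incidenceSign e v * incidenceSign e v = 1 := by
  rw [incidenceSign, ← pow_add, ← two_mul, pow_mul]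
  simp

lemma incidenceSign_eq_or {n : ℕ} (e : Finset (Fin n)) (v : Fin n) :
    incidenceSign e v = 1 ∨ incidenceSign e v = -1 :=
  neg_one_pow_eq_or ℤ _

lemma incidenceSign_insert {n : ℕ} {e : Finset (Fin n)} {u : Fin n} (hu : u ∉ e) (v : Fin n) :
    incidenceSign (insert u e) v = (if u < v then -1 else 1) * incidenceSign e v := by
  unfold incidenceSign
  rw [Finset.filter_insert]
  split_ifs with h
  · rw [Finset.card_insert_of_notMem (by simp [hu]), pow_succ]
    ring
  · simp

/-- Exactly one of `u < v` and `v < u` contributes a sign. This anticommutation gives both the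
vanishing of the squared Koszul differential and the contracting homotopy. -/
lemma incidenceSign_swap {n : ℕ} {e : Finset (Fin n)} {u v : Fin n} (hu : u ∉ e) (hv : v ∉ e)
    (huv : u ≠ v) :
    incidenceSign e v * incidenceSign (insert v e) u =
      -(incidenceSign e u * incidenceSign (insert u e) v) := by
  rw [incidenceSign_insert hu, incidenceSign_insert hv]
  rcases lt_or_gt_of_ne huv with h | h
  · simp only [h, h.not_gt, if_true, if_false]
    ring
  · simp only [h, h.not_gt, if_true, if_false]
    ring

/-- The vertices of `V` below `u`, other than `u`, are divided between `V \ T` and `T`, so the signs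
multiply. This compares Koszul signs at a complement with simplicial signs at `T`. -/
lemma incidenceSign_sdiff {n : ℕ} {V T : Finset (Fin n)} (hT : T ⊆ V) (u : Fin n) :
    incidenceSign (V \ T) u = incidenceSign V u * incidenceSign (T.erase u) u := by
  have h : (V.filter (· < u)).card
      = ((V \ T).filter (· < u)).card + ((T.erase u).filter (· < u)).card := by
    rw [← Finset.card_union_of_disjoint]
    · congr 1
      ext w
      have := @hT w
      simp only [Finset.mem_filter, Finset.mem_union, Finset.mem_sdiff, Finset.mem_erase]
      constructor
      · rintro ⟨hw, hwu⟩
        by_cases hwT : w ∈ T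
        · exact Or.inr ⟨⟨hwu.ne, hwT⟩, hwu⟩
        · exact Or.inl ⟨⟨hw, hwT⟩, hwu⟩
      · rintro (⟨⟨hw, -⟩, hwu⟩ | ⟨⟨-, hw⟩, hwu⟩)
        · exact ⟨hw, hwu⟩
        · exact ⟨this hw, hwu⟩
    · rw [Finset.disjoint_left]
      intro w hw hw'
      simp only [Finset.mem_filter, Finset.mem_sdiff, Finset.mem_erase] at hw hw'
      exact hw.1.2 hw'.1.2
  unfold incidenceSign
  rw [h, pow_add, mul_assoc, ← pow_add, ← two_mul, pow_mul]
  simp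

/-! ### Filtering the monomials of a polynomial -/

section FilterMonomials

variable {K : Type*} [Field K] {n : ℕ}

open Classical in
/-- The sum of the terms of `p` whose exponents satisfy `P`. -/
noncomputable def filterMonomials (P : (Fin n →₀ ℕ) → Prop) (p : MvPolynomial (Fin n) K) :
    MvPolynomial (Fin n) K :=
  ∑ β ∈ p.support with P β, monomial β (coeff β p)

open Classical in
lemma coeff_filterMonomials (P : (Fin n →₀ ℕ) → Prop) (p : MvPolynomial (Fin n) K)
    (β : Fin n →₀ ℕ) :
    coeff β (filterMonomials P p) = if P β then coeff β p else 0 := by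
  unfold filterMonomials
  rw [coeff_sum]
  simp only [coeff_monomial]
  rw [Finset.sum_ite_eq']
  by_cases hP : P β <;> by_cases hc : coeff β p = 0 <;> simp [hP, hc]

lemma filterMonomials_sum (P : (Fin n →₀ ℕ) → Prop) {ι : Type*} (s : Finset ι)
    (f : ι → MvPolynomial (Fin n) K) :
    filterMonomials P (∑ i ∈ s, f i) = ∑ i ∈ s, filterMonomials P (f i) := by
  ext β
  simp only [coeff_sum, coeff_filterMonomials]
  split_ifs <;> simp

lemma filterMonomials_zsmul (P : (Fin n →₀ ℕ) → Prop) (c : ℤ) (p : MvPolynomial (Fin n) K) :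
    filterMonomials P (c • p) = c • filterMonomials P p := by
  ext β
  simp only [coeff_filterMonomials, coeff_smul]
  split_ifs <;> simp

lemma filterMonomials_zero (P : (Fin n →₀ ℕ) → Prop) :
    filterMonomials P (0 : MvPolynomial (Fin n) K) = 0 := by
  ext β
  simp [coeff_filterMonomials]

lemma mem_support_filterMonomials {P : (Fin n →₀ ℕ) → Prop} {p : MvPolynomial (Fin n) K}
    {β : Fin n →₀ ℕ} : β ∈ (filterMonomials P p).support ↔ P β ∧ β ∈ p.support := by
  classical
  simp only [mem_support_iff, coeff_filterMonomials]
  split_ifs with h <;> simp [h]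

lemma filterMonomials_eq_self {P : (Fin n →₀ ℕ) → Prop} {p : MvPolynomial (Fin n) K}
    (h : ∀ β ∈ p.support, P β) : filterMonomials P p = p := by
  classical
  ext β
  rw [coeff_filterMonomials]
  split_ifs with hβ
  · rfl
  · exact (notMem_support_iff.mp fun hm => hβ (h β hm)).symm

/-- All monomials of `p` shift the condition in the same way, so `p` behaves as a homogeneous
element for the grading seen by `P` and `Q`. This covers multidegrees as well as total degrees. -/
lemma filterMonomials_mul {P Q : (Fin n →₀ ℕ) → Prop} {p : MvPolynomial (Fin n) K}
    (h : ∀ μ ∈ p.support, ∀ ν, P (μ + ν) ↔ Q ν) (q : MvPolynomial (Fin n) K) :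
    filterMonomials P (p * q) = p * filterMonomials Q q := by
  classical
  ext β
  have hterm : ∀ x ∈ Finset.HasAntidiagonal.antidiagonal β,
      coeff x.1 p * coeff x.2 (filterMonomials Q q) =
      if P β then coeff x.1 p * coeff x.2 q else 0 := by
    intro x hx
    rw [coeff_filterMonomials, ← Finset.HasAntidiagonal.mem_antidiagonal.mp hx]
    by_cases hp : coeff x.1 p = 0
    · simp [hp]
    · simp [h x.1 (mem_support_iff.mpr hp) x.2]
  rw [coeff_filterMonomials, coeff_mul, coeff_mul, Finset.sum_congr rfl hterm]
  split_ifs <;> simp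

end FilterMonomials

/-! ### The Koszul differential -/

section Koszul

variable (K : Type*) [Field K] {n : ℕ} {M N : Type*}
  [AddCommGroup M] [Module (MvPolynomial (Fin n) K) M]
  [AddCommGroup N] [Module (MvPolynomial (Fin n) K) N]

/-- The differential of the Koszul complex of the variables with coefficients in `M`, summed over
all homological degrees: a chain `f` stands for `∑ A, f A ⊗ e_A`. -/
noncomputable def koszulDiff :
    (Finset (Fin n) → M) →ₗ[MvPolynomial (Fin n) K] (Finset (Fin n) → M) :=
  LinearMap.pi fun A => ∑ v ∈ Aᶜ,
    incidenceSign A v • (X v : MvPolynomial (Fin n) K) • LinearMap.proj (insert v A)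

lemma koszulDiff_apply (f : Finset (Fin n) → M) (A : Finset (Fin n)) :
    koszulDiff K f A =
      ∑ v ∈ Aᶜ, incidenceSign A v • (X v : MvPolynomial (Fin n) K) • f (insert v A) := by
  simp [koszulDiff]

lemma koszulDiff_map (φ : M →ₗ[MvPolynomial (Fin n) K] N) (f : Finset (Fin n) → M) :
    koszulDiff K (fun A => φ (f A)) = fun A => φ (koszulDiff K f A) := by
  ext A
  simp only [koszulDiff_apply, map_sum, map_zsmul, map_smul]

lemma koszulDiff_koszulDiff (f : Finset (Fin n) → M) : koszulDiff K (koszulDiff K f) = 0 := by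
  ext A
  simp only [koszulDiff_apply, Finset.smul_sum]
  rw [Finset.sum_sigma', Pi.zero_apply]
  have key : ∀ u v : Fin n, u ∉ A → v ∉ A → u ≠ v →
      incidenceSign A v • (X v : MvPolynomial (Fin n) K) • incidenceSign (insert v A) u •
        (X u : MvPolynomial (Fin n) K) • f (insert u (insert v A)) =
      -(incidenceSign A u • (X u : MvPolynomial (Fin n) K) • incidenceSign (insert u A) v •
        (X v : MvPolynomial (Fin n) K) • f (insert v (insert u A))) := by
    intro u v hu hv huv
    rw [smul_comm (X v : MvPolynomial (Fin n) K), smul_comm (X u : MvPolynomial (Fin n) K) (_ : ℤ),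
      smul_smul (incidenceSign A v), smul_smul (incidenceSign A u), incidenceSign_swap hu hv huv,
      neg_smul, smul_comm (X u : MvPolynomial (Fin n) K)
        (X v : MvPolynomial (Fin n) K), Finset.insert_comm]
  refine Finset.sum_involution (fun p _ => ⟨p.2, p.1⟩) ?_ ?_ ?_ ?_
  · rintro ⟨v, u⟩ h
    simp only [Finset.mem_sigma, Finset.mem_compl, Finset.mem_insert, not_or] at h
    rw [key u v h.2.2 h.1 h.2.1, neg_add_cancel]
  · rintro ⟨v, u⟩ h - heq
    simp only [Finset.mem_sigma, Finset.mem_compl, Finset.mem_insert, not_or] at h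
    simp only [Sigma.mk.injEq] at heq
    exact h.2.1 heq.1
  · rintro ⟨v, u⟩ h
    simp only [Finset.mem_sigma, Finset.mem_compl, Finset.mem_insert, not_or] at h ⊢
    exact ⟨h.2.2, fun e => h.2.1 e.symm, h.1⟩
  · rintro ⟨v, u⟩ h
    rfl

end Koszul

/-! ### Multigraded contractions of the Koszul complex -/

section Contraction

variable {K : Type*} [Field K] {n : ℕ}

lemma X_mul_divMonomial_single {u v : Fin n} (huv : u ≠ v) (p : MvPolynomial (Fin n) K) :
    (X u * p).divMonomial (Finsupp.single v 1) = X u * p.divMonomial (Finsupp.single v 1) := by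
  ext β
  rw [coeff_divMonomial, coeff_X_mul', coeff_X_mul', coeff_divMonomial]
  have hmem : u ∈ (Finsupp.single v 1 + β).support ↔ u ∈ β.support := by
    simp [Finsupp.single_eq_of_ne huv]
  by_cases h : u ∈ β.support
  · rw [if_pos h, if_pos (hmem.mpr h)]
    congr 1
    ext w
    rcases eq_or_ne w u with rfl | hw
    · simp [Finsupp.single_eq_of_ne huv]
    · simp [Finsupp.single_eq_of_ne hw]
  · rw [if_neg h, if_neg fun h' => h (hmem.mp h')]

lemma zsmul_divMonomial (c : ℤ) (p : MvPolynomial (Fin n) K) (s : Fin n →₀ ℕ) :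
    (c • p).divMonomial s = c • p.divMonomial s := by
  ext β
  rw [coeff_divMonomial, coeff_smul, coeff_smul, coeff_divMonomial]

lemma sum_divMonomial {ι : Type*} (t : Finset ι) (f : ι → MvPolynomial (Fin n) K)
    (s : Fin n →₀ ℕ) : (∑ i ∈ t, f i).divMonomial s = ∑ i ∈ t, (f i).divMonomial s := by
  ext β
  simp [coeff_divMonomial, coeff_sum]

/-- The homotopy on Koszul chains which divides by the variable `v`. -/
noncomputable def contraction (v : Fin n) (f : Finset (Fin n) → MvPolynomial (Fin n) K) :
    Finset (Fin n) → MvPolynomial (Fin n) K := fun A =>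
  if v ∈ A then incidenceSign (A.erase v) v • (f (A.erase v)).divMonomial (Finsupp.single v 1) else 0

/-- Terms that add some `u ≠ v` cancel by anticommutation, or vanish if `v ∉ A`; what survives
removes and restores `v`. The homotopy is thus the identity up to monomials that carry `v` neither
in `A` nor as a variable. -/
lemma koszulDiff_contraction_add (v : Fin n) (f : Finset (Fin n) → MvPolynomial (Fin n) K)
    (A : Finset (Fin n)) :
    koszulDiff K (contraction v f) A + contraction v (koszulDiff K f) A =
      if v ∈ A then f A else X v * (f A).divMonomial (Finsupp.single v 1) := by
  by_cases hv : v ∈ A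
  · rw [if_pos hv, contraction, if_pos hv, koszulDiff_apply, koszulDiff_apply,
      Finset.compl_erase, Finset.sum_insert (by simpa using hv), Finset.insert_erase hv,
      add_divMonomial, sum_divMonomial, zsmul_divMonomial, smul_eq_mul, X_mul_divMonomial,
      smul_add, smul_smul, incidenceSign_mul_self, one_smul, Finset.smul_sum, add_left_comm,
      ← Finset.sum_add_distrib, Finset.sum_eq_zero, add_zero]
    intro u hu
    have huA : u ∉ A := by simpa using hu
    have huv : u ≠ v := fun h => huA (h ▸ hv)
    have huA' : u ∉ A.erase v := fun h => huA (Finset.mem_of_mem_erase h)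
    have hswap := incidenceSign_swap huA' (Finset.notMem_erase v A) huv
    rw [Finset.insert_erase hv] at hswap
    have hsign : incidenceSign A u * incidenceSign (insert u (A.erase v)) v =
        -(incidenceSign (A.erase v) v * incidenceSign (A.erase v) u) := by
      linear_combination incidenceSign (insert u (A.erase v)) v * incidenceSign (A.erase v) v * hswap
        - incidenceSign A u * incidenceSign (insert u (A.erase v)) v *
            incidenceSign_mul_self (A.erase v) v
        - incidenceSign (A.erase v) v * incidenceSign (A.erase v) u *
            incidenceSign_mul_self (insert u (A.erase v)) v
    rw [contraction, if_pos (Finset.mem_insert_of_mem hv), Finset.erase_insert_of_ne huv,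
      zsmul_divMonomial, smul_eq_mul, smul_eq_mul, X_mul_divMonomial_single huv, mul_smul_comm, smul_smul,
      smul_smul, hsign, neg_smul, neg_add_cancel]
  · rw [if_neg hv, contraction, if_neg hv, add_zero, koszulDiff_apply,
      Finset.sum_eq_single_of_mem v (by simpa using hv)]
    · rw [contraction, if_pos (Finset.mem_insert_self v A), Finset.erase_insert hv,
        smul_comm (X v : MvPolynomial (Fin n) K), smul_smul, incidenceSign_mul_self, one_smul,
        smul_eq_mul]
    · intro u _ huv
      rw [contraction, if_neg (by simp [hv, huv.symm])]
      simp

end Contraction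

/-! ### Characteristic vectors -/

section CharVec

variable {n : ℕ}

/-- The exponent of the squarefree monomial `∏ v ∈ A, X v`. -/
noncomputable def charVec (A : Finset (Fin n)) : Fin n →₀ ℕ :=
  Finsupp.equivFunOnFinite.symm fun v => if v ∈ A then 1 else 0

lemma charVec_apply (A : Finset (Fin n)) (v : Fin n) : charVec A v = if v ∈ A then 1 else 0 := rfl

lemma support_charVec (A : Finset (Fin n)) : (charVec A).support = A := by
  ext v
  simp [charVec_apply]

lemma degree_charVec (A : Finset (Fin n)) : (charVec A).degree = A.card := by
  rw [Finsupp.degree_apply, support_charVec, Finset.card_eq_sum_ones]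
  exact Finset.sum_congr rfl fun v hv => by simp [charVec_apply, hv]

lemma charVec_insert {A : Finset (Fin n)} {v : Fin n} (hv : v ∉ A) :
    charVec (insert v A) = Finsupp.single v 1 + charVec A := by
  ext w
  rcases eq_or_ne w v with rfl | hw
  · simp [charVec_apply, hv]
  · simp [charVec_apply, hw]

lemma charVec_le_iff {A : Finset (Fin n)} {β : Fin n →₀ ℕ} : charVec A ≤ β ↔ A ⊆ β.support := by
  constructor
  · intro h v hv
    have := h v
    simp only [charVec_apply, hv, if_true] at this
    simp only [Finsupp.mem_support_iff]
    omega
  · intro h v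
    rw [charVec_apply]
    split_ifs with hv
    · have := Finsupp.mem_support_iff.mp (h hv)
      omega
    · omega

lemma monomial_charVec (K : Type*) [Field K] (A : Finset (Fin n)) :
    monomial (charVec A) (1 : K) = ∏ v ∈ A, X v := by
  induction A using Finset.induction_on with
  | empty =>
    rw [Finset.prod_empty, show charVec (∅ : Finset (Fin n)) = 0 by ext; simp [charVec_apply]]
    rfl
  | insert v A hv ih =>
    rw [Finset.prod_insert hv, ← ih, charVec_insert hv, X, monomial_mul, one_mul]

lemma add_charVec_eq_charVec {B V : Finset (Fin n)} {β : Fin n →₀ ℕ}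
    (h : β + charVec B = charVec V) : B ⊆ V ∧ β = charVec (V \ B) := by
  have key : ∀ v, β v + (if v ∈ B then 1 else 0) = if v ∈ V then 1 else 0 := fun v => by
    simpa [charVec_apply] using DFunLike.congr_fun h v
  constructor
  · intro v hv
    by_contra hV
    simpa [hv, hV] using key v
  · ext v
    have := key v
    simp only [charVec_apply, Finset.mem_sdiff]
    have hBV : v ∈ B → v ∈ V := fun hv => by
      by_contra hV
      simp [hv, hV] at this
    by_cases hv : v ∈ B <;> by_cases hV : v ∈ V <;> simp_all

end CharVec

/-! ### Multigraded parts of Koszul chains and exactness -/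

section MultigradedPart

variable {K : Type*} [Field K] {n : ℕ}

lemma filterMonomials_koszulDiff {P Q : Finset (Fin n) → (Fin n →₀ ℕ) → Prop}
    (h : ∀ A, ∀ v ∉ A, ∀ ν, P A (Finsupp.single v 1 + ν) ↔ Q (insert v A) ν)
    (f : Finset (Fin n) → MvPolynomial (Fin n) K) (A : Finset (Fin n)) :
    filterMonomials (P A) (koszulDiff K f A) =
      koszulDiff K (fun B => filterMonomials (Q B) (f B)) A := by
  rw [koszulDiff_apply, koszulDiff_apply, filterMonomials_sum]
  refine Finset.sum_congr rfl fun v hv => ?_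
  rw [filterMonomials_zsmul, smul_eq_mul, smul_eq_mul, filterMonomials_mul (Q := Q (insert v A))]
  intro μ hμ ν
  rw [support_X, Finset.mem_singleton] at hμ
  rw [hμ, h A v (by simpa using hv)]

/-- The part of multidegree `α` of a Koszul chain. -/
noncomputable def multigradedPart (α : Fin n →₀ ℕ)
    (f : Finset (Fin n) → MvPolynomial (Fin n) K) : Finset (Fin n) → MvPolynomial (Fin n) K :=
  fun A => filterMonomials (fun β => β + charVec A = α) (f A)

lemma koszulDiff_multigradedPart (α : Fin n →₀ ℕ) {f : Finset (Fin n) → MvPolynomial (Fin n) K}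
    (hf : koszulDiff K f = 0) : koszulDiff K (multigradedPart α f) = 0 := by
  ext1 A
  have := filterMonomials_koszulDiff (P := fun A β => β + charVec A = α)
    (Q := fun A β => β + charVec A = α) (fun A v hv ν => by
      rw [charVec_insert hv]
      exact iff_of_eq (congrArg (· = α) (by abel))) f A
  rw [hf] at this
  rw [Pi.zero_apply, ← filterMonomials_zero (fun β => β + charVec A = α)]
  exact this.symm

/-- Only finitely many multidegrees occur in `f`, so preimages chosen for them can be added up. -/
lemma exists_koszulDiff_eq_of_multigradedPart (I : Ideal (MvPolynomial (Fin n) K))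
    (f : Finset (Fin n) → MvPolynomial (Fin n) K)
    (h : ∀ α, ∃ g, (∀ A, g A ∈ I) ∧ koszulDiff K g = multigradedPart α f) :
    ∃ g, (∀ A, g A ∈ I) ∧ koszulDiff K g = f := by
  classical
  choose g hgI hg using h
  set s : Finset (Fin n →₀ ℕ) :=
    Finset.univ.biUnion fun A => (f A).support.image fun β => β + charVec A with hs
  refine ⟨∑ α ∈ s, g α, fun A => ?_, ?_⟩
  · rw [Finset.sum_apply]
    exact I.sum_mem fun α _ => hgI α A
  · rw [map_sum, Finset.sum_congr rfl fun α _ => hg α]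
    ext A β
    rw [Finset.sum_apply, coeff_sum]
    simp only [multigradedPart, coeff_filterMonomials]
    have hsum := Finset.sum_ite_eq s (β + charVec A) fun _ => coeff β (f A)
    have hβ : coeff β (f A) ≠ 0 → β + charVec A ∈ s := fun hc => by
      rw [hs, Finset.mem_biUnion]
      exact ⟨A, Finset.mem_univ A, Finset.mem_image.mpr ⟨β, mem_support_iff.mpr hc, rfl⟩⟩
    rw [ite_eq_left_iff.mpr fun h => (not_not.mp (mt hβ h)).symm] at hsum
    convert hsum

lemma X_mul_divMonomial_cancel {v : Fin n} {p : MvPolynomial (Fin n) K}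
    (hp : ∀ β ∈ p.support, β v ≠ 0) : X v * p.divMonomial (Finsupp.single v 1) = p := by
  ext β
  rw [coeff_X_mul']
  split_ifs with h
  · rw [coeff_divMonomial, add_tsub_cancel_of_le]
    rw [Finsupp.single_le_iff]
    exact Nat.one_le_iff_ne_zero.mpr (Finsupp.mem_support_iff.mp h)
  · by_contra hc
    exact h (Finsupp.mem_support_iff.mpr (hp β (mem_support_iff.mpr (Ne.symm hc))))

/-- If `v ∉ A`, the factor `v` of the multidegree must come from the monomial, so dividing by `X v`
loses nothing and the homotopy is the identity on this part. -/
lemma koszulDiff_contraction_multigradedPart {α : Fin n →₀ ℕ} {v : Fin n} (hv : α v ≠ 0)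
    {f : Finset (Fin n) → MvPolynomial (Fin n) K} (hf : koszulDiff K f = 0) :
    koszulDiff K (contraction v (multigradedPart α f)) = multigradedPart α f := by
  ext1 A
  have h := koszulDiff_contraction_add v (multigradedPart α f) A
  rw [koszulDiff_multigradedPart α hf] at h
  have h0 : contraction v (0 : Finset (Fin n) → MvPolynomial (Fin n) K) A = 0 := by
    simp [contraction, zero_divMonomial]
  rw [h0, add_zero] at h
  rw [h]
  split_ifs with hvA
  · rfl
  · refine X_mul_divMonomial_cancel fun β hβ => ?_
    have := (mem_support_filterMonomials.mp hβ).1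
    rw [← this] at hv
    simpa [charVec_apply, hvA] using hv

lemma mem_support_contraction_multigradedPart {α : Fin n →₀ ℕ} {v : Fin n}
    {f : Finset (Fin n) → MvPolynomial (Fin n) K} {B : Finset (Fin n)} {β : Fin n →₀ ℕ}
    (hβ : β ∈ (contraction v (multigradedPart α f) B).support) :
    Finsupp.single v 1 + β ∈ (f (B.erase v)).support ∧ β + charVec B = α := by
  classical
  rw [mem_support_iff, contraction] at hβ
  split_ifs at hβ with hv
  · rw [coeff_smul, coeff_divMonomial] at hβ
    have h1 := mem_support_iff.mpr (right_ne_zero_of_smul hβ)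
    have h2 := mem_support_filterMonomials.mp h1
    refine ⟨h2.2, ?_⟩
    rw [← h2.1]
    conv_lhs => rw [← Finset.insert_erase hv, charVec_insert (Finset.notMem_erase v B)]
    abel
  · simp at hβ

theorem exists_koszulDiff_eq {f : Finset (Fin n) → MvPolynomial (Fin n) K}
    (hf : koszulDiff K f = 0) (h0 : constantCoeff (f ∅) = 0) : ∃ g, koszulDiff K g = f := by
  obtain ⟨g, -, hg⟩ := exists_koszulDiff_eq_of_multigradedPart (⊤ : Ideal _) f fun α => by
    -- Multidegree zero consists only of the constant term of `f ∅`, which vanishes by `h0`.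
    by_cases hα : α = 0
    · refine ⟨0, fun _ => Submodule.mem_top, ?_⟩
      rw [map_zero]
      ext A β
      by_contra hc
      have h := mem_support_filterMonomials.mp (mem_support_iff.mpr (Ne.symm hc))
      rw [hα, add_eq_zero] at h
      have hA : A = ∅ := by rw [← support_charVec A, h.1.2, Finsupp.support_zero]
      rw [h.1.1, hA, mem_support_iff] at h
      exact h.2 h0
    · obtain ⟨v, hv⟩ := DFunLike.ne_iff.mp hα
      exact ⟨_, fun _ => Submodule.mem_top, koszulDiff_contraction_multigradedPart hv hf⟩
  exact ⟨g, hg⟩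

lemma koszulDiff_pi_apply {ι : Type*} (f : Finset (Fin n) → ι → MvPolynomial (Fin n) K)
    (A : Finset (Fin n)) (a : ι) : koszulDiff K f A a = koszulDiff K (fun B => f B a) A :=
  (congrFun (koszulDiff_map K (LinearMap.proj (R := MvPolynomial (Fin n) K) a) f) A).symm

theorem exists_koszulDiff_eq_pi {ι : Type*} {f : Finset (Fin n) → ι → MvPolynomial (Fin n) K}
    (hf : koszulDiff K f = 0) (h0 : ∀ a, constantCoeff (f ∅ a) = 0) :
    ∃ g, koszulDiff K g = f := by
  have h : ∀ a, ∃ g, koszulDiff K g = fun A => f A a := fun a => by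
    refine exists_koszulDiff_eq ?_ (h0 a)
    ext1 A
    rw [← koszulDiff_pi_apply, hf]
    rfl
  choose g hg using h
  refine ⟨fun A a => g a A, ?_⟩
  ext1 A
  ext1 a
  rw [koszulDiff_pi_apply]
  exact congrFun (hg a) A

lemma mem_support_koszulDiff {f : Finset (Fin n) → MvPolynomial (Fin n) K} {A : Finset (Fin n)}
    {β : Fin n →₀ ℕ} (hβ : β ∈ (koszulDiff K f A).support) :
    ∃ v ∉ A, ∃ γ ∈ (f (insert v A)).support, β = Finsupp.single v 1 + γ := by
  classical
  rw [mem_support_iff, koszulDiff_apply, coeff_sum] at hβ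
  obtain ⟨v, hv, hne⟩ := Finset.exists_ne_zero_of_sum_ne_zero hβ
  rw [coeff_smul, smul_eq_mul] at hne
  have h := mem_support_iff.mpr (right_ne_zero_of_smul hne)
  rw [support_X_mul, Finset.mem_map] at h
  obtain ⟨γ, hγ, rfl⟩ := h
  exact ⟨v, by simpa using hv, γ, hγ, rfl⟩

end MultigradedPart

/-! ### Simplicial chains with coefficients in a field -/

section SimplicialChains

variable (K : Type*) [Field K] {n : ℕ}

/-- The boundary map on simplicial chains of the full simplex on `Fin n`. -/
noncomputable def simplicialBoundary : (Finset (Fin n) → K) →ₗ[K] (Finset (Fin n) → K) :=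
  LinearMap.pi fun e => ∑ v ∈ eᶜ, (incidenceSign e v : K) • LinearMap.proj (insert v e)

lemma simplicialBoundary_apply (z : Finset (Fin n) → K) (e : Finset (Fin n)) :
    simplicialBoundary K z e = ∑ v ∈ eᶜ, (incidenceSign e v : K) * z (insert v e) := by
  simp [simplicialBoundary]

/-- There are no non-zero cycles supported on `C`. -/
def IsCycleFree (C : Finset (Finset (Fin n))) : Prop :=
  ∀ z : Finset (Fin n) → K, (∀ F ∉ C, z F = 0) → simplicialBoundary K z = 0 → z = 0

variable {K}

lemma sum_mul_simplicialBoundary (η z : Finset (Fin n) → K) :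
    ∑ e, η e * simplicialBoundary K z e =
      ∑ T, z T * ∑ u ∈ T, (incidenceSign (T.erase u) u : K) * η (T.erase u) := by
  simp only [simplicialBoundary_apply, Finset.mul_sum]
  rw [Finset.sum_sigma', Finset.sum_sigma']
  refine Finset.sum_bij' (fun p _ => ⟨insert p.2 p.1, p.2⟩) (fun p _ => ⟨p.1.erase p.2, p.2⟩)
    ?_ ?_ ?_ ?_ ?_
  · simp
  · simp
  · rintro ⟨e, v⟩ h
    simp only [Finset.mem_sigma, Finset.mem_univ, true_and, Finset.mem_compl] at h
    simp [Finset.erase_insert h]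
  · rintro ⟨T, u⟩ h
    simp only [Finset.mem_sigma, Finset.mem_univ, true_and] at h
    simp [Finset.insert_erase h]
  · rintro ⟨e, v⟩ h
    simp only [Finset.mem_sigma, Finset.mem_univ, true_and, Finset.mem_compl] at h
    simp only [Finset.erase_insert h]
    ring

/-- Duality: the boundary is injective on chains supported on `C`, so its transpose maps onto the
functions on `C`. -/
lemma IsCycleFree.exists_cochain {C : Finset (Finset (Fin n))} (hC : IsCycleFree K C)
    (φ : Finset (Fin n) → K) : ∃ η : Finset (Fin n) → K, ∀ T ∈ C,
      ∑ u ∈ T, (incidenceSign (T.erase u) u : K) * η (T.erase u) = φ T := by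
  let off : (Finset (Fin n) → K) →ₗ[K] (Finset (Fin n) → K) :=
    LinearMap.pi fun F => if F ∈ C then 0 else LinearMap.proj F
  have hoff : ∀ z F, off z F = if F ∈ C then 0 else z F := fun z F => by
    simp only [off, LinearMap.pi_apply]
    split_ifs <;> simp
  -- Recording the values off `C` as well makes the boundary injective on all chains.
  obtain ⟨L, hL⟩ := LinearMap.exists_leftInverse_of_injective
    ((simplicialBoundary K).prod off) (by
      rw [LinearMap.ker_eq_bot']
      intro z hz
      have h1 : simplicialBoundary K z = 0 := congrArg Prod.fst hz
      have h2 : off z = 0 := congrArg Prod.snd hz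
      refine hC z (fun F hF => ?_) h1
      simpa [hoff, hF] using congrFun h2 F)
  -- On the boundary of a chain supported on `C`, `ψ` returns the pairing of that chain with `φ`;
  -- its values on unit vectors form the cochain.
  let ψ : (Finset (Fin n) → K) →ₗ[K] K :=
    (∑ F, φ F • LinearMap.proj F) ∘ₗ L ∘ₗ LinearMap.inl K _ _
  refine ⟨fun e => ψ (Pi.single e 1), fun T hT => ?_⟩
  have h1 := sum_mul_simplicialBoundary (fun e => ψ (Pi.single e 1)) (Pi.single T 1)
  rw [Finset.sum_eq_single T (f := fun T' => (Pi.single T (1 : K) : Finset (Fin n) → K) T' * _)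
    (fun T' _ h => by simp [Pi.single_eq_of_ne h]) (by simp), Pi.single_eq_same, one_mul] at h1
  rw [← h1]
  have h2 : ψ (simplicialBoundary K (Pi.single T 1)) = φ T := by
    have h3 : off (Pi.single T 1) = 0 := by
      ext F
      rw [hoff]
      split_ifs with hF
      · rfl
      · exact Pi.single_eq_of_ne (fun h : F = T => hF (h.symm ▸ hT)) _
    have h4 : L (simplicialBoundary K (Pi.single T 1), 0) = Pi.single T 1 := by
      rw [← h3]
      exact LinearMap.congr_fun hL (Pi.single T 1)
    simp only [ψ, LinearMap.comp_apply, LinearMap.inl_apply]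
    rw [h4]
    simp [Finset.sum_apply, Pi.single_apply]
  rw [← h2]
  conv_rhs => rw [← Finset.univ_sum_single (simplicialBoundary K (Pi.single T 1)), map_sum]
  refine Finset.sum_congr rfl fun e _ => ?_
  rw [mul_comm, ← smul_eq_mul, ← map_smul, ← Pi.single_smul, smul_eq_mul, mul_one]

lemma incidenceSign_cast_mul_self (e : Finset (Fin n)) (v : Fin n) :
    (incidenceSign e v : K) * incidenceSign e v = 1 := by
  exact_mod_cast congrArg (Int.cast : ℤ → K) (incidenceSign_mul_self e v)

lemma prod_incidenceSign_mul_self (V T : Finset (Fin n)) :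
    (∏ w ∈ T, (incidenceSign V w : K)) * ∏ w ∈ T, (incidenceSign V w : K) = 1 := by
  rw [← Finset.prod_mul_distrib]
  exact Finset.prod_eq_one fun w _ => incidenceSign_cast_mul_self V w

/-- Twisting cochains by products of signs turns the Koszul differential in squarefree multidegree
`V`, read at complements, into the simplicial coboundary. -/
lemma sum_incidenceSign_sdiff {V T : Finset (Fin n)} (hT : T ⊆ V) (η : Finset (Fin n) → K) :
    (∏ w ∈ T, (incidenceSign V w : K)) * ∑ u ∈ T, (incidenceSign (V \ T) u : K) * η (T.erase u) =
      ∑ u ∈ T, (incidenceSign (T.erase u) u : K) *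
        ((∏ w ∈ T.erase u, (incidenceSign V w : K)) * η (T.erase u)) := by
  rw [Finset.mul_sum]
  refine Finset.sum_congr rfl fun u hu => ?_
  rw [← Finset.mul_prod_erase T _ hu, incidenceSign_sdiff hT, Int.cast_mul]
  linear_combination (∏ w ∈ T.erase u, (incidenceSign V w : K)) * (incidenceSign (T.erase u) u : K) *
    η (T.erase u) * incidenceSign_cast_mul_self (K := K) V u

end SimplicialChains

/-! ### Circuit ideals -/

section CircuitIdeal

variable {K : Type*} [Field K] {n d : ℕ} {C : Finset (Finset (Fin n))}

/-- `I` is Koszul acyclic above degree `d` if the Koszul homology of the variables with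
coefficients in `I` vanishes in all polynomial degrees greater than `d`. -/
def KoszulAcyclicAbove (I : Ideal (MvPolynomial (Fin n) K)) (d : ℕ) : Prop :=
  ∀ f : Finset (Fin n) → MvPolynomial (Fin n) K, (∀ A, f A ∈ I) →
    (∀ A, ∀ β ∈ (f A).support, d < β.degree) → koszulDiff K f = 0 →
      ∃ g, (∀ A, g A ∈ I) ∧ koszulDiff K g = f

/-- A support with more than `d` elements contains a `(d + 1)`-set, hence by `hclique` a non-circuit
of size `d`. So `C` matters only for supports of size exactly `d`. -/
lemma mem_circuitIdeal_iff
    (hclique : ∀ W : Finset (Fin n), W.card = d + 1 → ¬ Finset.powersetCard d W ⊆ C)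
    {p : MvPolynomial (Fin n) K} :
    p ∈ circuitIdeal K d C ↔
      ∀ β ∈ p.support, d < β.support.card ∨ (β.support.card = d ∧ β.support ∉ C) := by
  have hspan : circuitIdeal K d C =
      Ideal.span ((fun s => monomial s (1 : K)) '' (charVec '' (complementClutter d C : Set _))) := by
    rw [circuitIdeal, clutterIdeal]
    congr 1
    ext f
    simp [monomial_charVec, eq_comm]
  rw [hspan, mem_ideal_span_monomial_image]
  refine forall₂_congr fun β _ => ?_
  simp only [Set.mem_image, Finset.mem_coe, exists_exists_and_eq_and, charVec_le_iff,
    complementClutter, Finset.mem_sdiff, Finset.mem_powersetCard, Finset.subset_univ, true_and]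
  constructor
  · rintro ⟨T, ⟨hTd, hTC⟩, hT⟩
    rcases (Finset.card_le_card hT).lt_or_eq with h | h
    · exact Or.inl (hTd ▸ h)
    · rw [← Finset.eq_of_subset_of_card_le hT h.ge]
      exact Or.inr ⟨hTd, hTC⟩
  · rintro (h | h)
    · obtain ⟨W, hW, hWd⟩ := Finset.exists_subset_card_eq (Nat.succ_le_of_lt h)
      obtain ⟨T, hT, hTC⟩ := Finset.not_subset.mp (hclique W hWd)
      rw [Finset.mem_powersetCard] at hT
      exact ⟨T, ⟨hT.2, hTC⟩, hT.1.trans hW⟩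
    · exact ⟨_, h, subset_rfl⟩

/-- If a Koszul chain `g` of squarefree multidegree `V` consists of polynomials of degree at least
`d`, then it can be moved into the circuit ideal of a cycle-free clutter by a boundary. -/
lemma exists_mem_circuitIdeal_of_squarefree (hC : IsCycleFree K C)
    (hclique : ∀ W : Finset (Fin n), W.card = d + 1 → ¬ Finset.powersetCard d W ⊆ C)
    (V : Finset (Fin n)) (g : Finset (Fin n) → MvPolynomial (Fin n) K)
    (hg : ∀ B, ∀ β ∈ (g B).support, B ⊆ V ∧ β = charVec (V \ B) ∧ d ≤ (V \ B).card) :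
    ∃ g' : Finset (Fin n) → MvPolynomial (Fin n) K,
      (∀ B, g' B ∈ circuitIdeal K d C) ∧ koszulDiff K g' = koszulDiff K g := by
  obtain ⟨η', hη'⟩ := hC.exists_cochain
    fun T => (∏ w ∈ T, (incidenceSign V w : K)) * coeff (charVec T) (g (V \ T))
  set η : Finset (Fin n) → K := fun U => (∏ w ∈ U, (incidenceSign V w : K)) * η' U with hη
  have hcob : ∀ T ∈ C, T ⊆ V → ∑ u ∈ T, (incidenceSign (V \ T) u : K) * η (T.erase u) =
      coeff (charVec T) (g (V \ T)) := by
    intro T hT hTV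
    have h1 := sum_incidenceSign_sdiff hTV η
    have h2 := hη' T hT
    have h3 := prod_incidenceSign_mul_self (K := K) V T
    simp only [hη, ← mul_assoc (∏ w ∈ _, _) (∏ w ∈ _, _), prod_incidenceSign_mul_self,
      one_mul] at h1
    rw [h2] at h1
    exact mul_left_cancel₀ (left_ne_zero_of_mul_eq_one h3) h1
  -- Coefficients of degree `d - 1` give a boundary in degree `d`, the only degree in which `g` can
  -- fail to lie in the ideal.
  let e : Finset (Fin n) → MvPolynomial (Fin n) K := fun B =>
    if B ⊆ V ∧ (V \ B).card + 1 = d then monomial (charVec (V \ B)) (η (V \ B)) else 0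
  have he : ∀ B, koszulDiff K e B = if B ⊆ V ∧ (V \ B).card = d then
      monomial (charVec (V \ B)) (∑ u ∈ V \ B, (incidenceSign B u : K) * η ((V \ B).erase u))
      else 0 := by
    intro B
    rw [koszulDiff_apply]
    have hterm : ∀ u ∈ Bᶜ, incidenceSign B u • (X u : MvPolynomial (Fin n) K) • e (insert u B) =
        if u ∈ V \ B then (if B ⊆ V ∧ (V \ B).card = d then
          monomial (charVec (V \ B)) ((incidenceSign B u : K) * η ((V \ B).erase u)) else 0)
        else 0 := by
      intro u hu
      rw [Finset.mem_compl] at hu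
      by_cases huV : u ∈ V
      · have huVB : u ∈ V \ B := Finset.mem_sdiff.mpr ⟨huV, hu⟩
        have hVB : V \ insert u B = (V \ B).erase u := by
          ext w
          simp only [Finset.mem_sdiff, Finset.mem_insert, Finset.mem_erase]
          tauto
        rw [if_pos huVB]
        simp only [e, hVB, Finset.card_erase_add_one huVB, Finset.insert_subset_iff, huV, true_and]
        split_ifs with hcond
        · rw [smul_eq_mul, X, monomial_mul, one_mul, ← charVec_insert (Finset.notMem_erase _ _),
            Finset.insert_erase huVB, ← zsmul_eq_mul, map_zsmul]
        · simp
      · rw [if_neg fun h => huV (Finset.mem_sdiff.mp h).1]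
        simp [e, Finset.insert_subset_iff, huV]
    rw [Finset.sum_congr rfl hterm, ← Finset.sum_filter]
    have hfil : Finset.filter (fun u => u ∈ V \ B) Bᶜ = V \ B := by
      ext w
      simp only [Finset.mem_filter, Finset.mem_compl, Finset.mem_sdiff]
      tauto
    rw [hfil]
    split_ifs
    · rw [map_sum]
    · simp
  refine ⟨g - koszulDiff K e, fun B => (mem_circuitIdeal_iff hclique).mpr fun β hβ => ?_, ?_⟩
  · have hB : B ⊆ V ∧ β = charVec (V \ B) ∧ d ≤ (V \ B).card := by
      by_cases h : β ∈ (g B).support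
      · exact hg B β h
      · rw [mem_support_iff, Pi.sub_apply, coeff_sub, notMem_support_iff.mp h, he B] at hβ
        split_ifs at hβ with hcond
        · rw [coeff_monomial] at hβ
          split_ifs at hβ with hβB
          · exact ⟨hcond.1, hβB.symm, hcond.2.ge⟩
          · simp at hβ
        · simp at hβ
    obtain ⟨hBV, rfl, hd⟩ := hB
    rw [support_charVec]
    rcases hd.lt_or_eq with h | h
    · exact Or.inl h
    -- At a circuit the coefficient of `g` is cancelled by the coboundary of `η`.
    · refine Or.inr ⟨h.symm, fun hmem => ?_⟩
      have hBB : V \ (V \ B) = B := by rw [Finset.sdiff_sdiff_eq_self hBV]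
      have := hcob _ hmem Finset.sdiff_subset
      rw [hBB] at this
      rw [mem_support_iff, Pi.sub_apply, coeff_sub, he B, if_pos ⟨hBV, h.symm⟩, coeff_monomial,
        if_pos rfl, this, sub_self] at hβ
      exact hβ rfl
  · rw [map_sub, koszulDiff_koszulDiff, sub_zero]

/-- If a variable occurs at least twice in the multidegree, contracting along it preserves supports
and stays in the ideal. In a squarefree multidegree the contraction may leave the ideal in degree
`d`, and cycle-freeness supplies the correction. -/
theorem koszulAcyclicAbove_of_isCycleFree (hC : IsCycleFree K C)
    (hclique : ∀ W : Finset (Fin n), W.card = d + 1 → ¬ Finset.powersetCard d W ⊆ C) :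
    KoszulAcyclicAbove (circuitIdeal K d C) d := by
  intro f hfI hfd hf
  refine exists_koszulDiff_eq_of_multigradedPart _ f fun α => ?_
  by_cases hα : ∃ v, 2 ≤ α v
  · obtain ⟨v, hv⟩ := hα
    refine ⟨_, fun B => (mem_circuitIdeal_iff hclique).mpr fun β hβ => ?_,
      koszulDiff_contraction_multigradedPart (v := v) (by omega) hf⟩
    obtain ⟨h1, h2⟩ := mem_support_contraction_multigradedPart hβ
    have h3 := (mem_circuitIdeal_iff hclique).mp (hfI _) _ h1
    have hsupp : (Finsupp.single v 1 + β).support = β.support := by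
      have hβv : β v ≠ 0 := fun h0 => by
        have := DFunLike.congr_fun h2 v
        rw [Finsupp.add_apply, h0, charVec_apply] at this
        split_ifs at this <;> omega
      ext w
      rcases eq_or_ne w v with rfl | hw
      · simp [hβv]
      · simp [Finsupp.single_eq_of_ne hw]
    rwa [hsupp] at h3
  · push Not at hα
    have hαV : α = charVec α.support := by
      ext w
      have := hα w
      rw [charVec_apply]
      split_ifs with hw <;> rw [Finsupp.mem_support_iff] at hw <;> omega
    by_cases h0 : α = 0
    · refine ⟨0, fun _ => Ideal.zero_mem _, ?_⟩
      rw [map_zero]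
      ext A β
      by_contra hc
      have h := mem_support_filterMonomials.mp (mem_support_iff.mpr (Ne.symm hc))
      rw [h0, add_eq_zero] at h
      have := hfd A β h.2
      simp [h.1.1] at this
    · obtain ⟨v, hv⟩ := DFunLike.ne_iff.mp h0
      obtain ⟨g, hgI, hg⟩ := exists_mem_circuitIdeal_of_squarefree hC hclique α.support
        (contraction v (multigradedPart α f)) fun B β hβ => by
          obtain ⟨h1, h2⟩ := mem_support_contraction_multigradedPart hβ
          rw [hαV] at h2
          obtain ⟨hB, hβB⟩ := add_charVec_eq_charVec h2
          refine ⟨hB, hβB, ?_⟩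
          have := hfd _ _ h1
          rw [map_add, Finsupp.degree_single, hβB, degree_charVec] at this
          omega
      exact ⟨g, hgI, hg.trans (koszulDiff_contraction_multigradedPart hv hf)⟩

/-- Acyclicity yields, for each circuit `T₀`, a cochain whose coboundary on `C` is, up to sign, the
indicator of `T₀`. Pairing it with a cycle shows that the cycle vanishes at `T₀`. -/
theorem KoszulAcyclicAbove.isCycleFree (hd : 1 ≤ d) (hCd : (C : Set (Finset (Fin n))).Sized d)
    (hclique : ∀ W : Finset (Fin n), W.card = d + 1 → ¬ Finset.powersetCard d W ⊆ C)
    (h : KoszulAcyclicAbove (circuitIdeal K d C) d) : IsCycleFree K C := by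
  intro z hz hbd
  ext T₀
  by_cases hT₀ : T₀ ∈ C
  swap
  · exact hz T₀ hT₀
  have hcard := hCd (Finset.mem_coe.mpr hT₀)
  -- This chain is not in the ideal, but its boundary is: the monomials there are squarefree of
  -- degree `d + 1`.
  set a : Finset (Fin n) → MvPolynomial (Fin n) K :=
    Pi.single T₀ᶜ (monomial (charVec T₀) 1) with ha
  have hsupp : ∀ A, ∀ β ∈ (koszulDiff K a A).support, ∃ v ∉ T₀, β = charVec (insert v T₀) := by
    intro A β hβ
    rw [mem_support_iff, koszulDiff_apply, coeff_sum] at hβ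
    obtain ⟨v, hv, hne⟩ := Finset.exists_ne_zero_of_sum_ne_zero hβ
    by_cases hA : insert v A = T₀ᶜ
    · have hvT : v ∉ T₀ := by
        rw [← Finset.mem_compl, ← hA]
        exact Finset.mem_insert_self v A
      refine ⟨v, hvT, ?_⟩
      by_contra hβ'
      refine hne ?_
      rw [hA, ha, Pi.single_eq_same, smul_eq_mul, X, monomial_mul, ← charVec_insert hvT, coeff_smul,
        coeff_monomial, if_neg fun h => hβ' h.symm, smul_zero]
    · rw [ha, Pi.single_eq_of_ne hA] at hne
      simp at hne
  obtain ⟨w, hwI, hw⟩ := h (koszulDiff K a)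
    (fun A => (mem_circuitIdeal_iff hclique).mpr fun β hβ => by
      obtain ⟨v, hv, rfl⟩ := hsupp A β hβ
      rw [support_charVec, Finset.card_insert_of_notMem hv]
      omega)
    (fun A β hβ => by
      obtain ⟨v, hv, rfl⟩ := hsupp A β hβ
      rw [degree_charVec, Finset.card_insert_of_notMem hv]
      omega)
    (koszulDiff_koszulDiff K a)
  have hw0 : ∀ T ∈ C, ∀ A, coeff (charVec T) (w A) = 0 := by
    intro T hT A
    by_contra hc
    have := (mem_circuitIdeal_iff hclique).mp (hwI A) _ (mem_support_iff.mpr hc)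
    rw [support_charVec, hCd (Finset.mem_coe.mpr hT)] at this
    rcases this with h | h
    · omega
    · exact h.2 hT
  -- Elements of the ideal have no coefficient at a circuit, so on circuits the boundary of `b` has
  -- the same coefficients as `a`.
  obtain ⟨b, hb⟩ := exists_koszulDiff_eq (f := a - w) (by rw [map_sub, hw, sub_self]) (by
    have h1 : constantCoeff (a ∅) = 0 := by
      rw [ha, Pi.single_apply]
      split_ifs
      · rw [constantCoeff_monomial, if_neg]
        intro h0
        have := congrArg Finsupp.degree h0
        rw [degree_charVec, map_zero] at this
        omega
      · simp
    have h2 : constantCoeff (w ∅) = 0 := by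
      by_contra hc
      have := (mem_circuitIdeal_iff hclique).mp (hwI ∅) 0 (mem_support_iff.mpr hc)
      simp at this
      omega
    rw [Pi.sub_apply, map_sub, h1, h2, sub_zero])
  have hcoeff : ∀ T ∈ C, ∑ u ∈ T, (incidenceSign (Finset.univ \ T) u : K) *
      coeff (charVec (T.erase u)) (b (T.erase u)ᶜ) = if T = T₀ then 1 else 0 := by
    intro T hT
    have h1 := congrArg (coeff (charVec T)) (congrFun hb Tᶜ)
    rw [Pi.sub_apply, coeff_sub, hw0 T hT, sub_zero, koszulDiff_apply, coeff_sum, compl_compl] at h1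
    have h2 : coeff (charVec T) (a Tᶜ) = if T = T₀ then 1 else 0 := by
      rw [ha, Pi.single_apply]
      by_cases hTT : T = T₀
      · simp [hTT]
      · simp [hTT]
    rw [← h2, ← h1]
    refine Finset.sum_congr rfl fun u hu => ?_
    rw [coeff_smul, smul_eq_mul, Finset.compl_erase, Finset.compl_eq_univ_sdiff]
    conv_rhs => rw [← Finset.insert_erase hu, charVec_insert (Finset.notMem_erase u T),
      Finset.insert_erase hu, coeff_X_mul, zsmul_eq_mul]
  set η : Finset (Fin n) → K := fun U => coeff (charVec U) (b Uᶜ) with hη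
  have hsum := sum_mul_simplicialBoundary
    (fun U => (∏ w ∈ U, (incidenceSign Finset.univ w : K)) * η U) z
  simp only [hbd, Pi.zero_apply, mul_zero, Finset.sum_const_zero] at hsum
  rw [Finset.sum_eq_single T₀] at hsum
  · rw [← sum_incidenceSign_sdiff (Finset.subset_univ _), hcoeff T₀ hT₀, if_pos rfl, mul_one,
      eq_comm, mul_eq_zero] at hsum
    exact hsum.resolve_right
      (left_ne_zero_of_mul_eq_one (prod_incidenceSign_mul_self (K := K) Finset.univ T₀))
  · intro T _ hT
    by_cases hTC : T ∈ C
    · rw [← sum_incidenceSign_sdiff (Finset.subset_univ _), hcoeff T hTC, if_neg hT]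
      simp
    · rw [hz T hTC, zero_mul]
  · simp

end CircuitIdeal

/-! ### Koszul acyclicity of ideals with a linear resolution -/

section LinearResolution

variable {K : Type*} [Field K] {n : ℕ}

lemma isHomogeneous_iff_degree {p : MvPolynomial (Fin n) K} {m : ℕ} :
    p.IsHomogeneous m ↔ ∀ β ∈ p.support, β.degree = m := by
  constructor
  · intro h β hβ
    by_contra hne
    exact mem_support_iff.mp hβ (h.coeff_eq_zero hne)
  · intro h β hβ
    rw [← h β (mem_support_iff.mpr hβ), Finsupp.degree_eq_weight_one]
    rfl

lemma filterMonomials_sum_mul {ι : Type*} [Fintype ι] (P : ℕ → Prop) (s : ℕ) (t : ι → ℕ)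
    (c v : ι → MvPolynomial (Fin n) K) (hc : ∀ b, ∀ μ ∈ (c b).support, μ.degree + s = t b) :
    filterMonomials (fun β => P (β.degree + s)) (∑ b, c b * v b) =
      ∑ b, c b * filterMonomials (fun β => P (β.degree + t b)) (v b) := by
  rw [filterMonomials_sum]
  refine Finset.sum_congr rfl fun b _ => filterMonomials_mul (fun μ hμ ν => ?_) _
  rw [map_add, ← hc b μ hμ, show μ.degree + ν.degree + s = ν.degree + (μ.degree + s) by ring]

/-- The difference `g - u` is a cycle over a free module without constant term at `∅`, hence a
boundary; applying `φ` removes `u`. -/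
lemma exists_koszulDiff_eq_of_lift {ι N : Type*} [AddCommGroup N] [Module (MvPolynomial (Fin n) K) N]
    (φ : (ι → MvPolynomial (Fin n) K) →ₗ[MvPolynomial (Fin n) K] N)
    {g u : Finset (Fin n) → ι → MvPolynomial (Fin n) K}
    (hg : ∀ a, constantCoeff (g ∅ a) = 0) (hu : ∀ a, constantCoeff (u ∅ a) = 0)
    (hφu : ∀ A, φ (u A) = 0) (hug : koszulDiff K u = koszulDiff K g) :
    ∃ w : Finset (Fin n) → ι → MvPolynomial (Fin n) K,
      koszulDiff K (fun A => φ (w A)) = fun A => φ (g A) := by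
  obtain ⟨w, hw⟩ := exists_koszulDiff_eq_pi (f := g - u) (by rw [map_sub, hug, sub_self])
    (fun a => by rw [Pi.sub_apply, Pi.sub_apply, map_sub, hg, hu, sub_zero])
  refine ⟨w, ?_⟩
  rw [koszulDiff_map, hw]
  ext1 A
  rw [Pi.sub_apply, map_sub, hφu, sub_zero]

lemma lt_degree_koszulDiff {ι : Type*} {s : ι → ℕ} {m : ℕ}
    {g : Finset (Fin n) → ι → MvPolynomial (Fin n) K}
    (hg : ∀ A a, ∀ β ∈ (g A a).support, m < β.degree + s a) (A : Finset (Fin n)) (a : ι) :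
    ∀ β ∈ (koszulDiff K g A a).support, m + 1 < β.degree + s a := by
  intro β hβ
  rw [koszulDiff_pi_apply] at hβ
  obtain ⟨v, -, γ, hγ, rfl⟩ := mem_support_koszulDiff hβ
  have := hg _ a γ hγ
  rw [map_add, Finsupp.degree_single]
  omega

lemma constantCoeff_eq_zero_of_lt_degree {p : MvPolynomial (Fin n) K} {m s : ℕ}
    (hp : ∀ β ∈ p.support, m < β.degree + s) (hs : s ≤ m) : constantCoeff p = 0 := by
  by_contra hc
  have := hp 0 (mem_support_iff.mpr hc)
  rw [map_zero] at this
  omega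

variable {I : Ideal (MvPolynomial (Fin n) K)}

lemma MinimalGradedFreeResolution.constantCoeff_eq_zero (F : MinimalGradedFreeResolution I) {i : ℕ}
    {u : Fin (F.rank i) → MvPolynomial (Fin n) K}
    (hu : u ∈ LinearMap.range (F.diff i).mulVecLin) (a : Fin (F.rank i)) :
    constantCoeff (u a) = 0 := by
  obtain ⟨x, rfl⟩ := hu
  rw [Matrix.mulVecLin_apply, Matrix.mulVec, dotProduct, map_sum]
  exact Finset.sum_eq_zero fun b _ => by rw [map_mul, F.minimal, zero_mul]

/-- Vanishing of the Koszul homology of the syzygy modules of a linear resolution, by induction on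
the homological degree. -/
lemma MinimalGradedFreeResolution.exists_koszulDiff_eq_syzygy (F : MinimalGradedFreeResolution I)
    {d : ℕ} (hF : ∀ i a, F.shift i a ≤ i + d) (p : ℕ) : ∀ (i : ℕ)
    (f : Finset (Fin n) → Fin (F.rank i) → MvPolynomial (Fin n) K)
    (_ : ∀ A, f A ∈ LinearMap.range (F.diff i).mulVecLin)
    (_ : ∀ A a, ∀ β ∈ (f A a).support, i + 1 + d < β.degree + F.shift i a)
    (_ : ∀ A, p ≤ A.card → f A = 0) (_ : koszulDiff K f = 0),
    ∃ g, (∀ A, g A ∈ LinearMap.range (F.diff i).mulVecLin) ∧ koszulDiff K g = f := by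
  induction p with
  | zero =>
    intro i f _ _ hp _
    refine ⟨0, fun _ => Submodule.zero_mem _, ?_⟩
    rw [map_zero]
    ext1 A
    exact (hp A (Nat.zero_le _)).symm
  | succ p ih =>
    intro i f hf hdeg hp hcyc
    choose g₀ hg₀ using hf
    -- Truncating the lift in degree and in the size of `A` does not change its image, since `f`
    -- already satisfies both bounds.
    let g : Finset (Fin n) → Fin (F.rank (i + 1)) → MvPolynomial (Fin n) K := fun A b =>
      if p + 1 ≤ A.card then 0
      else filterMonomials (fun β => i + 1 + d < β.degree + F.shift (i + 1) b) (g₀ A b)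
    have hgdeg : ∀ A b, ∀ β ∈ (g A b).support, i + 1 + d < β.degree + F.shift (i + 1) b := by
      intro A b β hβ
      simp only [g] at hβ
      split_ifs at hβ with hA
      · simp at hβ
      · exact (mem_support_filterMonomials.mp hβ).1
    have hgf : (fun A => (F.diff i).mulVecLin (g A)) = f := by
      ext1 A
      by_cases hA : p + 1 ≤ A.card
      · rw [hp A hA, show g A = 0 from funext fun b => if_pos hA, map_zero]
      · ext1 a
        rw [← filterMonomials_eq_self (hdeg A a), ← hg₀ A]
        simp only [Matrix.mulVecLin_apply, Matrix.mulVec, dotProduct]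
        rw [filterMonomials_sum_mul (fun k => i + 1 + d < k) (F.shift i a) (F.shift (i + 1)) _ _
          fun b μ hμ => F.diff_homogeneous i a b μ hμ]
        exact Finset.sum_congr rfl fun b _ => by simp only [g, if_neg hA]
    -- The differential of the lift lies in the next syzygy module. The degree bound rises by one
    -- and the bound on the size of `A` drops by one.
    obtain ⟨u, hu, hug⟩ := ih (i + 1) (koszulDiff K g)
      (fun A => by
        rw [F.exact_succ, LinearMap.mem_ker]
        have := congrFun (koszulDiff_map K (F.diff i).mulVecLin g) A
        rw [← this, hgf, hcyc, Pi.zero_apply])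
      (fun A a => by
        rw [show i + 1 + 1 + d = i + 1 + d + 1 by ring]
        exact lt_degree_koszulDiff hgdeg A a)
      (fun A hA => by
        rw [koszulDiff_apply]
        refine Finset.sum_eq_zero fun v hv => ?_
        have hc : p + 1 ≤ (insert v A).card := by
          rw [Finset.card_insert_of_notMem (by simpa using hv)]
          omega
        rw [show g (insert v A) = 0 from funext fun b => if_pos hc, smul_zero, smul_zero])
      (koszulDiff_koszulDiff K g)
    -- The constant terms of `g` vanish by the bound on the shifts, those of `u` by minimality.
    obtain ⟨w, hw⟩ := exists_koszulDiff_eq_of_lift (F.diff i).mulVecLin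
      (fun a => constantCoeff_eq_zero_of_lt_degree (hgdeg ∅ a) (hF (i + 1) a))
      (fun a => F.constantCoeff_eq_zero (hu ∅) a)
      (fun A => by
        have := hu A
        rwa [F.exact_succ, LinearMap.mem_ker] at this) hug
    exact ⟨_, fun A => ⟨w A, rfl⟩, hw.trans hgf⟩

theorem MinimalGradedFreeResolution.koszulAcyclicAbove (F : MinimalGradedFreeResolution I)
    {d : ℕ} (hF : ∀ i a, F.shift i a ≤ i + d) : KoszulAcyclicAbove I d := by
  intro f hf hdeg hcyc
  set φ := Fintype.linearCombination (MvPolynomial (Fin n) K) F.aug with hφ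
  have hf' : ∀ A, f A ∈ LinearMap.range φ := fun A => by
    rw [F.range_aug]
    exact hf A
  choose g₀ hg₀ using hf'
  let g : Finset (Fin n) → Fin (F.rank 0) → MvPolynomial (Fin n) K := fun A b =>
    filterMonomials (fun β => d < β.degree + F.shift 0 b) (g₀ A b)
  have hgdeg : ∀ A b, ∀ β ∈ (g A b).support, d < β.degree + F.shift 0 b :=
    fun A b β hβ => (mem_support_filterMonomials.mp hβ).1
  have hgf : (fun A => φ (g A)) = f := by
    ext1 A
    rw [← filterMonomials_eq_self (hdeg A), ← hg₀ A]
    simp only [hφ, Fintype.linearCombination_apply, smul_eq_mul, mul_comm _ (F.aug _)]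
    exact (filterMonomials_sum_mul (fun k => d < k) 0 (F.shift 0) F.aug (g₀ A)
      fun b μ hμ => isHomogeneous_iff_degree.mp (F.aug_homogeneous b) μ hμ).symm
  -- No subset of `Fin n` has `n + 1` elements, so the vanishing condition is void.
  obtain ⟨u, hu, hug⟩ := F.exists_koszulDiff_eq_syzygy hF (n + 1) 0 (koszulDiff K g)
    (fun A => by
      rw [F.exact_zero, LinearMap.mem_ker]
      have := congrFun (koszulDiff_map K φ g) A
      rw [← this, hgf, hcyc, Pi.zero_apply])
    (fun A a => by
      rw [show 0 + 1 + d = d + 1 by ring]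
      exact lt_degree_koszulDiff hgdeg A a)
    (fun A hA => by
      have := Finset.card_le_univ A
      rw [Fintype.card_fin] at this
      omega)
    (koszulDiff_koszulDiff K g)
  obtain ⟨w, hw⟩ := exists_koszulDiff_eq_of_lift φ
    (fun a => constantCoeff_eq_zero_of_lt_degree (hgdeg ∅ a) ((hF 0 a).trans (by omega)))
    (fun a => F.constantCoeff_eq_zero (hu ∅) a)
    (fun A => by
      have := hu A
      rwa [F.exact_zero, LinearMap.mem_ker] at this) hug
  exact ⟨_, fun A => F.range_aug.le ⟨w A, rfl⟩, hw.trans hgf⟩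

theorem HasLinearResolution.koszulAcyclicAbove {d : ℕ} (h : HasLinearResolution I d) :
    KoszulAcyclicAbove I d := by
  rcases h with rfl | ⟨⟨F, hF⟩, -⟩
  · intro f hf _ _
    refine ⟨0, fun _ => Ideal.zero_mem _, ?_⟩
    rw [map_zero]
    ext1 A
    exact ((Submodule.mem_bot _).mp (hf A)).symm
  · refine F.koszulAcyclicAbove fun i a => ?_
    have := hF.1 ⟨i, F.shift i a, ?_, rfl⟩
    · omega
    · rw [MinimalGradedFreeResolution.betti, ← pos_iff_ne_zero, Finset.card_pos]
      exact ⟨a, by simp⟩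

end LinearResolution

/-! ### Existence of linear resolutions -/

section ExistsLinearResolution

variable {K : Type*} [Field K] {n : ℕ}

/-- A graded submodule of a free module which starts in degree `j` and whose Koszul homology
vanishes above polynomial degree `j`. -/
structure IsLinearModule {ι : Type*} (M : Submodule (MvPolynomial (Fin n) K)
    (ι → MvPolynomial (Fin n) K)) (j : ℕ) : Prop where
  filter_mem : ∀ (P : ℕ → Prop), ∀ v ∈ M, (fun a => filterMonomials (fun β => P β.degree) (v a)) ∈ M
  le_degree : ∀ v ∈ M, ∀ a, ∀ β ∈ (v a).support, j ≤ β.degree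
  acyclic : ∀ f : Finset (Fin n) → ι → MvPolynomial (Fin n) K, (∀ A, f A ∈ M) →
    (∀ A a, ∀ β ∈ (f A a).support, j < β.degree) → koszulDiff K f = 0 →
      ∃ g, (∀ A, g A ∈ M) ∧ koszulDiff K g = f

variable {ι : Type*}
  {M : Submodule (MvPolynomial (Fin n) K) (ι → MvPolynomial (Fin n) K)} {j : ℕ}

/-- A linear module is generated by its elements of lowest degree. -/
lemma IsLinearModule.le_of_homogeneous_le [Finite ι] (hM : IsLinearModule M j)
    (N : Submodule (MvPolynomial (Fin n) K) (ι → MvPolynomial (Fin n) K))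
    (hN : ∀ w ∈ M, (∀ a, (w a).IsHomogeneous j) → w ∈ N) : M ≤ N := by
  classical
  have := Fintype.ofFinite ι
  have key : ∀ m, ∀ w ∈ M, (∀ a, (w a).IsHomogeneous m) → w ∈ N := by
    intro m
    induction m with
    | zero =>
      intro w hw hwm
      by_cases hj : j = 0
      · exact hN w hw (hj ▸ hwm)
      · have h0 : w = 0 := by
          ext1 a
          by_contra hne
          obtain ⟨β, hβ⟩ := support_nonempty.mpr hne
          have h1 := hM.le_degree w hw a β hβ
          have h2 := isHomogeneous_iff_degree.mp (hwm a) β hβ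
          omega
        rw [h0]
        exact N.zero_mem
    | succ m ih =>
      intro w hw hwm
      rcases lt_trichotomy j (m + 1) with hj | hj | hj
      -- Placed at `∅`, any element is a cycle; bounding it writes `w` as a combination of variables
      -- times elements of `M` of degree one less.
      · obtain ⟨g, hgM, hg⟩ := hM.acyclic (Pi.single ∅ w)
          (fun A => by
            rcases eq_or_ne A ∅ with rfl | hA
            · rwa [Pi.single_eq_same]
            · rw [Pi.single_eq_of_ne hA]
              exact M.zero_mem)
          (fun A a β hβ => by
            rcases eq_or_ne A ∅ with rfl | hA
            · rw [Pi.single_eq_same] at hβ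
              rwa [isHomogeneous_iff_degree.mp (hwm a) β hβ]
            · rw [Pi.single_eq_of_ne hA] at hβ
              simp at hβ)
          (by
            ext1 A
            rw [koszulDiff_apply]
            exact Finset.sum_eq_zero fun v _ => by
              rw [Pi.single_eq_of_ne (Finset.insert_ne_empty v A), smul_zero, smul_zero])
        let g' : Finset (Fin n) → ι → MvPolynomial (Fin n) K := fun A a =>
          filterMonomials (fun β => β.degree = m) (g A a)
        have hg' : ∀ A, g' A ∈ N := fun A => ih _ (hM.filter_mem (· = m) _ (hgM A))
          fun a => isHomogeneous_iff_degree.mpr fun β hβ => (mem_support_filterMonomials.mp hβ).1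
        have hwg : w = koszulDiff K g' ∅ := by
          ext1 a
          have h1 := filterMonomials_koszulDiff (P := fun _ β => β.degree = m + 1)
            (Q := fun _ β => β.degree = m) (fun A v _ ν => by
              rw [map_add, Finsupp.degree_single]
              omega) (fun A => g A a) ∅
          rw [koszulDiff_pi_apply, ← h1, ← koszulDiff_pi_apply, hg, Pi.single_eq_same]
          exact (filterMonomials_eq_self (isHomogeneous_iff_degree.mp (hwm a))).symm
        rw [hwg, koszulDiff_apply]
        exact N.sum_mem fun v _ => zsmul_mem (N.smul_mem _ (hg' _)) _
      · exact hN w hw (hj ▸ hwm)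
      · have h0 : w = 0 := by
          ext1 a
          by_contra hne
          obtain ⟨β, hβ⟩ := support_nonempty.mpr hne
          have h1 := hM.le_degree w hw a β hβ
          have h2 := isHomogeneous_iff_degree.mp (hwm a) β hβ
          omega
        rw [h0]
        exact N.zero_mem
  intro w hw
  set s : Finset ℕ := Finset.univ.biUnion fun a => (w a).support.image Finsupp.degree with hs
  have hsum : w = ∑ k ∈ s, fun a => filterMonomials (fun β => β.degree = k) (w a) := by
    ext a β
    rw [Finset.sum_apply, coeff_sum]
    simp only [coeff_filterMonomials]
    have h1 := Finset.sum_ite_eq s β.degree fun _ => coeff β (w a)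
    have hβ : coeff β (w a) ≠ 0 → β.degree ∈ s := fun hc => by
      rw [hs, Finset.mem_biUnion]
      exact ⟨a, Finset.mem_univ a, Finset.mem_image.mpr ⟨β, mem_support_iff.mpr hc, rfl⟩⟩
    rw [ite_eq_left_iff.mpr fun h => (not_not.mp (mt hβ h)).symm] at h1
    convert h1.symm
  rw [hsum]
  exact N.sum_mem fun k _ => key k _ (hM.filter_mem (· = k) w hw) fun a =>
    isHomogeneous_iff_degree.mpr fun β hβ => (mem_support_filterMonomials.mp hβ).1

/-- The syzygies of a linear module with respect to a basis of its lowest degree part form a linear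
module starting in degree one. -/
lemma IsLinearModule.ker_mulVecLin (hM : IsLinearModule M j) {s : ℕ}
    {B : Matrix ι (Fin s) (MvPolynomial (Fin n) K)} (hBj : ∀ a b, (B a b).IsHomogeneous j)
    (hB : LinearMap.range B.mulVecLin = M)
    (hli : LinearIndependent K fun b a => B a b) :
    IsLinearModule (LinearMap.ker B.mulVecLin) 1 := by
  have hfil : ∀ (P Q : ℕ → Prop) (_ : ∀ k, P (j + k) ↔ Q k) (v : Fin s → MvPolynomial (Fin n) K) a,
      filterMonomials (fun β => P β.degree) (B.mulVecLin v a) =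
        B.mulVecLin (fun b => filterMonomials (fun β => Q β.degree) (v b)) a := by
    intro P Q hPQ v a
    simp only [Matrix.mulVecLin_apply, Matrix.mulVec, dotProduct]
    rw [filterMonomials_sum]
    refine Finset.sum_congr rfl fun b _ => filterMonomials_mul (fun μ hμ ν => ?_) _
    rw [map_add, isHomogeneous_iff_degree.mp (hBj a b) μ hμ]
    exact hPQ _
  have hfilter : ∀ (P : ℕ → Prop), ∀ v ∈ LinearMap.ker B.mulVecLin,
      (fun b => filterMonomials (fun β => P β.degree) (v b)) ∈ LinearMap.ker B.mulVecLin := by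
    intro P v hv
    rw [LinearMap.mem_ker] at hv ⊢
    ext1 a
    rw [← hfil (fun k => P (k - j)) P (fun k => by rw [Nat.add_sub_cancel_left]) v a, hv]
    exact filterMonomials_zero _
  refine ⟨hfilter, fun v hv b β hβ => ?_, fun f hf hdeg hcyc => ?_⟩
  -- Constant terms of a syzygy would form a linear relation over `K` between the columns of `B`.
  · rw [Nat.one_le_iff_ne_zero]
    intro hβ0
    rw [Finsupp.degree_eq_zero_iff] at hβ0
    rw [hβ0, mem_support_iff] at hβ
    refine hβ ?_
    have h1 := LinearMap.mem_ker.mp (hfilter (· = 0) v hv)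
    have h2 : ∀ b, filterMonomials (fun β => β.degree = 0) (v b) = C (coeff 0 (v b)) := by
      classical
      intro b
      ext β
      rw [coeff_filterMonomials, coeff_C]
      by_cases h : β = 0
      · simp [h]
      · rw [if_neg (fun h' => h ((Finsupp.degree_eq_zero_iff β).mp h')), if_neg (Ne.symm h)]
    refine Fintype.linearIndependent_iff.mp hli (fun b => coeff 0 (v b)) ?_ b
    ext1 a
    have h3 := congrFun h1 a
    simp only [h2, Matrix.mulVecLin_apply, Matrix.mulVec, dotProduct] at h3
    rw [Finset.sum_apply, ← h3]
    exact Finset.sum_congr rfl fun b _ => by rw [Pi.smul_apply, smul_eq_C_mul, mul_comm]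
  -- A diagram chase: `f` bounds `g'` in the free module, the image of `g'` is a cycle in `M` above
  -- degree `j` and so a boundary, and subtracting a lifted boundary moves `g'` into the kernel.
  · obtain ⟨g, hg⟩ := exists_koszulDiff_eq_pi hcyc fun a => by
      by_contra hc
      have := hdeg ∅ a 0 (mem_support_iff.mpr hc)
      simp at this
    let g' : Finset (Fin n) → Fin s → MvPolynomial (Fin n) K := fun A b =>
      filterMonomials (fun β => 1 ≤ β.degree) (g A b)
    have hg' : koszulDiff K g' = f := by
      ext1 A
      ext1 b
      have h1 := filterMonomials_koszulDiff (P := fun _ β => 1 < β.degree)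
        (Q := fun _ β => 1 ≤ β.degree) (fun A v _ ν => by
          rw [map_add, Finsupp.degree_single]
          omega) (fun A => g A b) A
      rw [koszulDiff_pi_apply, ← h1, ← koszulDiff_pi_apply, hg]
      exact filterMonomials_eq_self (hdeg A b)
    obtain ⟨h, hhM, hh⟩ := hM.acyclic (fun A => B.mulVecLin (g' A))
      (fun A => hB.le ⟨_, rfl⟩)
      (fun A a β hβ => by
        rw [← hfil (fun k => j + 1 ≤ k) (fun k => 1 ≤ k) (fun k => by omega)] at hβ
        exact (mem_support_filterMonomials.mp hβ).1)
      (by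
        rw [koszulDiff_map, hg']
        ext1 A
        exact LinearMap.mem_ker.mp (hf A))
    choose h' hh' using fun A => hB.ge (hhM A)
    refine ⟨g' - koszulDiff K h', fun A => ?_, ?_⟩
    · have h1 := congrFun (koszulDiff_map K B.mulVecLin h') A
      simp only [hh', hh] at h1
      rw [LinearMap.mem_ker, Pi.sub_apply, map_sub, ← h1, sub_self]
    · rw [map_sub, koszulDiff_koszulDiff, sub_zero, hg']

/-- The columns are a `K`-basis of the degree `j` part: spanning gives generation of `M`, and
independence gives minimality. -/
theorem IsLinearModule.exists_matrix [Finite ι] (hM : IsLinearModule M j) :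
    ∃ (s : ℕ) (B : Matrix ι (Fin s) (MvPolynomial (Fin n) K)),
      (∀ a b, (B a b).IsHomogeneous j) ∧ LinearMap.range B.mulVecLin = M ∧
        IsLinearModule (LinearMap.ker B.mulVecLin) 1 := by
  have := Fintype.ofFinite ι
  let H : Submodule K (ι → MvPolynomial (Fin n) K) :=
    Submodule.pi Set.univ fun _ => homogeneousSubmodule (Fin n) K j
  have hH : Module.Finite K H :=
    Module.Finite.iff_fg.mpr (Submodule.fg_pi fun _ => homogeneousSubmodule_fg _ _ j)
  let W : Submodule K (ι → MvPolynomial (Fin n) K) := M.restrictScalars K ⊓ H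
  have hW : Module.Finite K W := Submodule.finiteDimensional_of_le inf_le_right
  let b := Module.finBasis K W
  let B : Matrix ι (Fin (Module.finrank K W)) (MvPolynomial (Fin n) K) :=
    fun a i => (b i : ι → MvPolynomial (Fin n) K) a
  have hBj : ∀ a i, (B a i).IsHomogeneous j := fun a i => (b i).2.2 a (Set.mem_univ a)
  have hcol : ∀ i, (b i : ι → MvPolynomial (Fin n) K) ∈ LinearMap.range B.mulVecLin := fun i => by
    rw [Matrix.range_mulVecLin]
    exact Submodule.subset_span ⟨i, rfl⟩
  have hB : LinearMap.range B.mulVecLin = M := by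
    refine le_antisymm ?_ (hM.le_of_homogeneous_le _ fun w hw hwj => ?_)
    · rw [Matrix.range_mulVecLin, Submodule.span_le]
      rintro _ ⟨i, rfl⟩
      exact (b i).2.1
    · have h1 := congrArg (Subtype.val : W → _)
        (b.sum_repr ⟨w, hw, fun a _ => (mem_homogeneousSubmodule j _).mpr (hwj a)⟩)
      rw [AddSubmonoidClass.coe_finsetSum] at h1
      change _ = w at h1
      rw [← h1]
      exact Submodule.sum_mem _ fun i _ => Submodule.smul_of_tower_mem _ _ (hcol i)
  exact ⟨_, B, hBj, hB, hM.ker_mulVecLin hBj hB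
    (b.linearIndependent.map' W.subtype (Submodule.ker_subtype W))⟩

theorem hasLinearResolution_of_koszulAcyclicAbove {I : Ideal (MvPolynomial (Fin n) K)} {d : ℕ}
    (hfil : ∀ (P : ℕ → Prop), ∀ p ∈ I, filterMonomials (fun β => P β.degree) p ∈ I)
    (hdeg : ∀ p ∈ I, ∀ β ∈ p.support, d ≤ β.degree) (hI : KoszulAcyclicAbove I d) :
    HasLinearResolution I d := by
  by_cases hbot : I = ⊥
  · exact Or.inl hbot
  right
  let J : Submodule (MvPolynomial (Fin n) K) (Fin 1 → MvPolynomial (Fin n) K) :=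
    Submodule.comap (LinearMap.proj 0) I
  have hJ : IsLinearModule J d :=
    { filter_mem := fun P v hv => hfil P (v 0) hv
      le_degree := fun v hv a => by
        rw [Subsingleton.elim a 0]
        exact hdeg (v 0) hv
      acyclic := fun f hf hfd hcyc => by
        obtain ⟨g, hg, hgf⟩ := hI (fun A => f A 0) hf (fun A => hfd A 0) (by
          ext1 A
          rw [← koszulDiff_pi_apply, hcyc]
          rfl)
        refine ⟨fun A _ => g A, hg, ?_⟩
        ext1 A
        ext1 a
        rw [koszulDiff_pi_apply, Subsingleton.elim a 0]
        exact congrFun hgf A }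
  obtain ⟨s₀, B₀, hB₀, hrange₀, hker₀⟩ := hJ.exists_matrix
  -- Degrees of syzygies are counted relative to the basis vectors, so every syzygy module starts in
  -- degree 1 and the construction iterates; the true shift in step `i` is `d + i`.
  let State := Σ r : ℕ, {M : Submodule (MvPolynomial (Fin n) K) (Fin r → MvPolynomial (Fin n) K) //
    IsLinearModule M 1}
  choose s B hB hrange hker using fun x : State => x.2.2.exists_matrix
  let st : ℕ → State := fun i =>
    Nat.rec ⟨s₀, LinearMap.ker B₀.mulVecLin, hker₀⟩ (fun _ x => ⟨s x, _, hker x⟩) i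
  have haug : ∀ v, Fintype.linearCombination (MvPolynomial (Fin n) K) (B₀ 0) v =
      B₀.mulVecLin v 0 := fun v => by
    simp only [Fintype.linearCombination_apply, Matrix.mulVecLin_apply, Matrix.mulVec, dotProduct,
      smul_eq_mul, mul_comm]
  have hmemI : ∀ a, B₀ 0 a ∈ I := fun a => by
    have h1 : B₀.col a ∈ J := by
      rw [← hrange₀, Matrix.range_mulVecLin]
      exact Submodule.subset_span ⟨a, rfl⟩
    exact h1
  let F : MinimalGradedFreeResolution I :=
    { rank := fun i => (st i).1
      shift := fun i _ => d + i
      aug := B₀ 0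
      diff := fun i => B (st i)
      aug_homogeneous := fun a => hB₀ 0 a
      diff_homogeneous := fun i a b m hm => by
        rw [isHomogeneous_iff_degree.mp (hB (st i) a b) m hm]
        omega
      range_aug := by
        refine le_antisymm ?_ fun p hp => ?_
        · rintro _ ⟨v, rfl⟩
          rw [haug]
          exact hrange₀.le ⟨v, rfl⟩
        · obtain ⟨v, hv⟩ := hrange₀.ge (show (fun _ => p) ∈ J from hp)
          exact ⟨v, by rw [haug, hv]⟩
      exact_zero := by
        refine (hrange (st 0)).trans ?_
        ext v
        rw [LinearMap.mem_ker, haug]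
        change v ∈ LinearMap.ker B₀.mulVecLin ↔ _
        rw [LinearMap.mem_ker]
        constructor
        · intro h
          rw [h, Pi.zero_apply]
        · intro h
          ext1 a
          rw [Subsingleton.elim a 0, h, Pi.zero_apply]
      exact_succ := fun i => hrange (st (i + 1))
      minimal := fun i a b => by
        by_contra hc
        have := isHomogeneous_iff_degree.mp (hB (st i) a b) 0 (mem_support_iff.mpr hc)
        simp at this }
  obtain ⟨a, ha⟩ : ∃ a, B₀ 0 a ≠ 0 := by
    by_contra! h
    refine hbot ((Submodule.eq_bot_iff _).mpr fun p hp => ?_)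
    obtain ⟨v, hv⟩ := F.range_aug.ge hp
    rw [← hv, Fintype.linearCombination_apply]
    exact Finset.sum_eq_zero fun b _ => by rw [show F.aug b = 0 from h b, smul_zero]
  refine ⟨⟨F, ?_, ?_⟩, ⟨B₀ 0 a, hmemI a, ha, hB₀ 0 a⟩, ?_⟩
  · rintro _ ⟨i, k, hik, rfl⟩
    rw [MinimalGradedFreeResolution.betti, ← pos_iff_ne_zero, Finset.card_pos] at hik
    obtain ⟨b, hb⟩ := hik
    have h1 : d + i = k := (Finset.mem_filter.mp hb).2
    omega
  · intro r hr
    refine hr ⟨0, d, ?_, by simp⟩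
    rw [MinimalGradedFreeResolution.betti, ← pos_iff_ne_zero, Finset.card_pos]
    exact ⟨a, Finset.mem_filter.mpr ⟨Finset.mem_univ _, rfl⟩⟩
  · rintro i ⟨p, hp, hp0, hpi⟩
    obtain ⟨β, hβ⟩ := support_nonempty.mpr hp0
    rw [← isHomogeneous_iff_degree.mp hpi β hβ]
    exact hdeg p hp β hβ

end ExistsLinearResolution

/-! ### Pseudo-manifolds -/

section PseudoManifold

variable {n d : ℕ} {C : Finset (Finset (Fin n))}

lemma IsPseudoManifold.degree_eq_two (hC : IsPseudoManifold d C) {e : Finset (Fin n)} {v : Fin n}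
    (hv : v ∉ e) (hF : insert v e ∈ C) : circuitDegree C e = 2 := by
  refine hC.2.2 e (Finset.mem_filter.mpr ⟨Finset.mem_univ _, ?_, _, hF, Finset.subset_insert v e⟩)
  rw [← Finset.card_insert_of_notMem hv]
  exact hC.1 (Finset.mem_coe.mpr hF)

/-- The circuits through a submaximal circuit are given by two vertices. -/
lemma IsPseudoManifold.insert_mem_iff (hC : IsPseudoManifold d C) {e : Finset (Fin n)}
    {v w : Fin n} (hv : v ∉ e) (hw : w ∉ e) (hvw : v ≠ w) (hF : insert v e ∈ C)
    (hG : insert w e ∈ C) {u : Fin n} (hu : u ∉ e) : insert u e ∈ C ↔ u = v ∨ u = w := by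
  constructor
  · intro hu'
    by_contra! hne
    have hinj : ∀ {x y : Fin n}, x ∉ e → y ∉ e → x ≠ y → insert x e ≠ insert y e := by
      intro x y hx _ hxy h
      have := h ▸ Finset.mem_insert_self x e
      simp [hx, hxy] at this
    have h3 : ({insert u e, insert v e, insert w e} : Finset (Finset (Fin n))).card = 3 :=
      Finset.card_eq_three.mpr ⟨_, _, _, hinj hu hv hne.1, hinj hu hw hne.2, hinj hv hw hvw, rfl⟩
    have hle : ({insert u e, insert v e, insert w e} : Finset (Finset (Fin n))) ⊆
        C.filter (fun F => e ⊆ F) := by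
      intro F hF'
      simp only [Finset.mem_insert, Finset.mem_singleton] at hF'
      rcases hF' with rfl | rfl | rfl <;> simp [*]
    have h2 := hC.degree_eq_two hv hF
    have := Finset.card_le_card hle
    rw [circuitDegree] at h2
    omega
  · rintro (rfl | rfl)
    exacts [hF, hG]

lemma IsPseudoManifold.exists_ne (hC : IsPseudoManifold d C) {e : Finset (Fin n)} {v : Fin n}
    (hv : v ∉ e) (hF : insert v e ∈ C) : ∃ w ∉ e, v ≠ w ∧ insert w e ∈ C := by
  obtain ⟨G, hG, hne⟩ := Finset.exists_mem_ne (s := C.filter (fun F => e ⊆ F))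
    (by rw [← circuitDegree, hC.degree_eq_two hv hF]; omega) (insert v e)
  rw [Finset.mem_filter] at hG
  have hcard : G.card = e.card + 1 := by
    rw [hC.1 (Finset.mem_coe.mpr hG.1), ← hC.1 (Finset.mem_coe.mpr hF),
      Finset.card_insert_of_notMem hv]
  obtain ⟨w, hw⟩ := Finset.covBy_iff_exists_insert.mp
    (Finset.covBy_iff_card_sdiff_eq_one.mpr ⟨hG.2, by rw [Finset.card_sdiff_of_subset hG.2]; omega⟩)
  refine ⟨w, hw.1, ?_, hw.2 ▸ hG.1⟩
  rintro rfl
  exact hne hw.2.symm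

lemma exists_insert_of_card_inter {A B : Finset (Fin n)} (hA : A.card = d) (hB : B.card = d)
    (h : (A ∩ B).card + 1 = d) :
    ∃ (e : Finset (Fin n)) (v w : Fin n), v ∉ e ∧ w ∉ e ∧ v ≠ w ∧ A = insert v e ∧
      B = insert w e := by
  have key : ∀ {X Y : Finset (Fin n)}, X ⊆ Y → Y.card = X.card + 1 → ∃ v ∉ X, insert v X = Y :=
    fun {X Y} hXY hc => Finset.covBy_iff_exists_insert.mp
      (Finset.covBy_iff_card_sdiff_eq_one.mpr ⟨hXY, by rw [Finset.card_sdiff_of_subset hXY]; omega⟩)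
  obtain ⟨v, hv, hvA⟩ := key (Finset.inter_subset_left (s₁ := A) (s₂ := B)) (by omega)
  obtain ⟨w, hw, hwB⟩ := key (Finset.inter_subset_right (s₁ := A) (s₂ := B)) (by omega)
  refine ⟨A ∩ B, v, w, hv, hw, ?_, hvA.symm, hwB.symm⟩
  rintro rfl
  have : A = B := hvA.symm.trans hwB
  subst this
  rw [Finset.inter_self] at h
  omega

/-- A property of circuits which passes to neighbours holds for all circuits. -/
lemma IsPseudoManifold.forall_of_insert (hC : IsPseudoManifold d C) {P : Finset (Fin n) → Prop}
    (hP : ∀ (e : Finset (Fin n)) (v w : Fin n), v ∉ e → w ∉ e → v ≠ w → insert v e ∈ C →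
      insert w e ∈ C → P (insert v e) → P (insert w e))
    {F : Finset (Fin n)} (hF : F ∈ C) (hPF : P F) : ∀ G ∈ C, P G := by
  intro G hG
  induction hC.2.1 F hF G hG with
  | refl => exact hPF
  | tail _ hAB ih =>
    obtain ⟨hA, hB, hcard⟩ := hAB
    obtain ⟨e, v, w, hv, hw, hvw, rfl, rfl⟩ := exists_insert_of_card_inter
      (hC.1 (Finset.mem_coe.mpr hA)) (hC.1 (Finset.mem_coe.mpr hB)) hcard
    exact hP e v w hv hw hvw hA hB (ih hA)

/-- Suppose all `d`-subsets of `W` are circuits. Across each submaximal face of a circuit in `W`,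
the second circuit is already supplied by `W`, so strong connectivity keeps all of `C` inside `W`.
-/
lemma IsPseudoManifold.not_powersetCard_subset (hC : IsPseudoManifold d C)
    (hsimplex : ∀ W : Finset (Fin n), W.card = d + 1 → C ≠ Finset.powersetCard d W)
    (W : Finset (Fin n)) (hW : W.card = d + 1) : ¬ Finset.powersetCard d W ⊆ C := by
  intro hsub
  obtain ⟨F, hF⟩ : (Finset.powersetCard d W).Nonempty :=
    Finset.powersetCard_nonempty.mpr (by omega)
  have hall := hC.forall_of_insert (P := fun F => F ⊆ W) ?_ (hsub hF)
    (Finset.mem_powersetCard.mp hF).1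
  · refine hsimplex W hW (Finset.Subset.antisymm (fun G hG => ?_) hsub)
    exact Finset.mem_powersetCard.mpr ⟨hall G hG, hC.1 (Finset.mem_coe.mpr hG)⟩
  · intro e v w hv hw hvw hvC hwC hvW
    rw [Finset.insert_subset_iff] at hvW
    have hecard : e.card + 1 = d := by
      rw [← Finset.card_insert_of_notMem hv]
      exact hC.1 (Finset.mem_coe.mpr hvC)
    obtain ⟨x, hx⟩ : (W \ insert v e).Nonempty := by
      rw [← Finset.card_pos, Finset.card_sdiff_of_subset
        (Finset.insert_subset_iff.mpr hvW), Finset.card_insert_of_notMem hv]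
      omega
    rw [Finset.mem_sdiff, Finset.mem_insert, not_or] at hx
    have hxC : insert x e ∈ C := hsub (Finset.mem_powersetCard.mpr
      ⟨Finset.insert_subset_iff.mpr ⟨hx.1, hvW.2⟩, by
        rw [Finset.card_insert_of_notMem hx.2.2, hecard]⟩)
    rcases (hC.insert_mem_iff hv hw hvw hvC hwC hx.2.2).mp hxC with rfl | rfl
    · exact absurd rfl hx.2.1
    · exact Finset.insert_subset_iff.mpr ⟨hx.1, hvW.2⟩

lemma complexDim_cliqueComplex (hne : C.Nonempty) (hCd : (C : Set (Finset (Fin n))).Sized d)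
    (hclique : ∀ W : Finset (Fin n), W.card = d + 1 → ¬ Finset.powersetCard d W ⊆ C) :
    complexDim (cliqueComplex d C) = (d : ℤ) - 1 := by
  have h : (cliqueComplex d C).sup Finset.card = d := by
    refine le_antisymm (Finset.sup_le fun V hV => ?_) ?_
    · by_contra! hlt
      obtain ⟨W, hW, hWd⟩ := Finset.exists_subset_card_eq (Nat.succ_le_of_lt hlt)
      exact hclique W hWd
        ((Finset.powersetCard_mono hW).trans (Finset.mem_filter.mp hV).2)
    · obtain ⟨F, hF⟩ := hne
      have hFd : F.card = d := hCd (Finset.mem_coe.mpr hF)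
      have hmem : F ∈ cliqueComplex d C := by
        refine Finset.mem_filter.mpr ⟨Finset.mem_univ _, ?_⟩
        rw [← hFd, Finset.powersetCard_self, Finset.singleton_subset_iff]
        exact hF
      calc d = F.card := hFd.symm
        _ ≤ _ := Finset.le_sup (f := Finset.card) hmem
  rw [complexDim, h]

variable {K : Type*} [Field K]

lemma IsPseudoManifold.simplicialBoundary_apply (hC : IsPseudoManifold d C)
    {z : Finset (Fin n) → K} (hz : ∀ F ∉ C, z F = 0) {e : Finset (Fin n)}
    {v w : Fin n} (hv : v ∉ e) (hw : w ∉ e) (hvw : v ≠ w) (hF : insert v e ∈ C)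
    (hG : insert w e ∈ C) : simplicialBoundary K z e =
      (incidenceSign e v : K) * z (insert v e) + (incidenceSign e w : K) * z (insert w e) := by
  rw [_root_.simplicialBoundary_apply,
    ← Finset.sum_pair (f := fun u => (incidenceSign e u : K) * z (insert u e)) hvw]
  refine (Finset.sum_subset (fun u hu => ?_) fun u hu huv => ?_).symm
  · simp only [Finset.mem_insert, Finset.mem_singleton] at hu
    rcases hu with rfl | rfl <;> simpa
  · rw [hz, mul_zero]
    intro h
    have := (hC.insert_mem_iff hv hw hvw hF hG (Finset.mem_compl.mp hu)).mp h
    simp only [Finset.mem_insert, Finset.mem_singleton] at huv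
    exact huv this

lemma IsPseudoManifold.simplicialBoundary_eq_zero_iff (hC : IsPseudoManifold d C)
    {z : Finset (Fin n) → K} (hz : ∀ F ∉ C, z F = 0) :
    simplicialBoundary K z = 0 ↔ ∀ (e : Finset (Fin n)) (v w : Fin n), v ∉ e → w ∉ e → v ≠ w →
      insert v e ∈ C → insert w e ∈ C →
        (incidenceSign e v : K) * z (insert v e) + (incidenceSign e w : K) * z (insert w e) = 0 := by
  constructor
  · intro h e v w hv hw hvw hF hG
    rw [← hC.simplicialBoundary_apply hz hv hw hvw hF hG, h, Pi.zero_apply]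
  · intro h
    ext e
    by_cases hex : ∃ v ∉ e, insert v e ∈ C
    · obtain ⟨v, hv, hF⟩ := hex
      obtain ⟨w, hw, hvw, hG⟩ := hC.exists_ne hv hF
      rw [hC.simplicialBoundary_apply hz hv hw hvw hF hG, h e v w hv hw hvw hF hG, Pi.zero_apply]
    · push Not at hex
      rw [_root_.simplicialBoundary_apply]
      exact Finset.sum_eq_zero fun v hv => by
        rw [hz _ (hex v (Finset.mem_compl.mp hv)), mul_zero]

lemma incidenceSign_cast_eq_or (e : Finset (Fin n)) (v : Fin n) :
    (incidenceSign e v : K) = 1 ∨ (incidenceSign e v : K) = -1 := by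
  rcases incidenceSign_eq_or e v with h | h <;> simp [h]

/-- Up to signs, cycles on a pseudo-manifold are constant. -/
lemma IsPseudoManifold.eq_or_eq_neg (hC : IsPseudoManifold d C)
    {z : Finset (Fin n) → K} (hz : ∀ F ∉ C, z F = 0) (hbd : simplicialBoundary K z = 0)
    {F : Finset (Fin n)} (hF : F ∈ C) : ∀ G ∈ C, z G = z F ∨ z G = -z F := by
  refine hC.forall_of_insert (fun e v w hv hw hvw hvC hwC h => ?_) hF (Or.inl rfl)
  have h0 := (hC.simplicialBoundary_eq_zero_iff hz).mp hbd e v w hv hw hvw hvC hwC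
  have h1 : z (insert w e) = z (insert v e) ∨ z (insert w e) = -z (insert v e) := by
    rcases incidenceSign_cast_eq_or (K := K) e v with h2 | h2 <;>
    rcases incidenceSign_cast_eq_or (K := K) e w with h3 | h3 <;> rw [h2, h3] at h0
    · exact Or.inr (by linear_combination h0)
    · exact Or.inl (by linear_combination -h0)
    · exact Or.inl (by linear_combination h0)
    · exact Or.inr (by linear_combination -h0)
  rcases h with h | h <;> rcases h1 with h1 | h1 <;> rw [h1, h] <;> simp

/-- A cycle on `C'` vanishes at a circuit of `C` missing from `C'`, hence everywhere. -/
lemma IsPseudoManifold.isCycleFree_of_ssubset (hC : IsPseudoManifold d C)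
    {C' : Finset (Finset (Fin n))} (hC' : C' ⊂ C) : IsCycleFree K C' := by
  intro z hz hbd
  obtain ⟨F, hF, hFC'⟩ := Finset.exists_of_ssubset hC'
  have hzC : ∀ G ∉ C, z G = 0 := fun G hG => hz G fun h => hG (hC'.1 h)
  ext G
  by_cases hG : G ∈ C
  · simpa [hz F hFC'] using hC.eq_or_eq_neg hzC hbd hF G hG
  · exact hzC G hG

/-- A coherent orientation is an integral cycle with coefficients `±1`, which stays non-zero in
every field. -/
lemma IsPseudoManifold.not_isCycleFree_of_isOrientable (hC : IsPseudoManifold d C)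
    (hne : C.Nonempty) (hor : IsOrientable C) : ¬ IsCycleFree K C := by
  obtain ⟨ε, hε⟩ := hor
  obtain ⟨F, hF⟩ := hne
  intro h
  have hz : ∀ G ∉ C, (if G ∈ C then ((ε G : ℤ) : K) else 0) = 0 := fun G hG => if_neg hG
  have h0 := congrFun (h _ hz ((hC.simplicialBoundary_eq_zero_iff hz).mpr
    fun e v w hv hw hvw hvC hwC => by
      have := congrArg (Int.cast : ℤ → K) (hε e v w hv hw hvw hvC hwC)
      push_cast at this
      rw [if_pos hvC, if_pos hwC]
      linear_combination this)) F
  simp only [hF, if_true, Pi.zero_apply] at h0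
  rcases Int.units_eq_one_or (ε F) with h1 | h1 <;> simp [h1] at h0

/-- Signs disappear in characteristic 2, and the sum of all circuits is a cycle. -/
lemma IsPseudoManifold.not_isCycleFree_of_charTwo [CharP K 2] (hC : IsPseudoManifold d C)
    (hne : C.Nonempty) : ¬ IsCycleFree K C := by
  obtain ⟨F, hF⟩ := hne
  intro h
  have hz : ∀ G ∉ C, (if G ∈ C then (1 : K) else 0) = 0 := fun G hG => if_neg hG
  have hsign : ∀ (e : Finset (Fin n)) (v : Fin n), (incidenceSign e v : K) = 1 := fun e v => by
    rcases incidenceSign_cast_eq_or (K := K) e v with h | h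
    · exact h
    · rw [h, CharTwo.neg_eq]
  have h0 := congrFun (h _ hz ((hC.simplicialBoundary_eq_zero_iff hz).mpr
    fun e v w hv hw hvw hvC hwC => by
      rw [if_pos hvC, if_pos hwC, hsign, hsign, mul_one, CharTwo.add_self_eq_zero])) F
  simp [hF] at h0

/-- Divided by one of its non-zero values, a cycle takes only the values `±1` on `C` and reads as an
orientation. As `2 ≠ 0`, a sum of two signs that vanishes in `K` already vanishes in `ℤ`. -/
lemma IsPseudoManifold.isOrientable_of_not_isCycleFree (hC : IsPseudoManifold d C)
    (h2 : (2 : K) ≠ 0) (h : ¬ IsCycleFree K C) : IsOrientable C := by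
  classical
  unfold IsCycleFree at h
  push Not at h
  obtain ⟨z, hz, hbd, hne⟩ := h
  obtain ⟨F, hzF⟩ := Function.ne_iff.mp hne
  rw [Pi.zero_apply] at hzF
  have hF : F ∈ C := by
    by_contra hF
    exact hzF (hz F hF)
  let ε : Finset (Fin n) → ℤˣ := fun G => if z G = z F then 1 else -1
  have hε : ∀ G ∈ C, z G = ((ε G : ℤ) : K) * z F := fun G hG => by
    simp only [ε]
    split_ifs with h
    · simp [h]
    · simp [(hC.eq_or_eq_neg hz hbd hF G hG).resolve_left h]
  refine ⟨ε, fun e v w hv hw hvw hvC hwC => ?_⟩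
  have h0 := (hC.simplicialBoundary_eq_zero_iff hz).mp hbd e v w hv hw hvw hvC hwC
  rw [hε _ hvC, hε _ hwC] at h0
  have h1 : (((ε (insert v e) : ℤ) * incidenceSign e v +
      (ε (insert w e) : ℤ) * incidenceSign e w : ℤ) : K) = 0 := by
    refine mul_right_cancel₀ hzF ?_
    push_cast
    linear_combination h0
  have hpm : ∀ (G : Finset (Fin n)) (u : Fin n),
      (ε G : ℤ) * incidenceSign e u = 1 ∨ (ε G : ℤ) * incidenceSign e u = -1 := fun G u => by
    rcases Int.units_eq_one_or (ε G) with h | h <;>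
    rcases incidenceSign_eq_or e u with h' | h' <;> simp [h, h']
  rcases hpm (insert v e) v with h3 | h3 <;> rcases hpm (insert w e) w with h4 | h4 <;>
    rw [h3, h4] at h1 ⊢
  · exact absurd (by simpa [one_add_one_eq_two] using h1) h2
  · simp
  · refine absurd ?_ h2
    push_cast at h1
    linear_combination -h1

end PseudoManifold

/-! ### Linearity of circuit ideals in terms of cycles -/

section Linearity

variable {K : Type*} [Field K] {n d : ℕ} {C : Finset (Finset (Fin n))}

/-- A `d`-uniform clutter without cliques on `d + 1` vertices has a circuit ideal with a `d`-linear
resolution if and only if it carries no cycles. -/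
theorem hasLinearResolution_circuitIdeal_iff (hd : 1 ≤ d)
    (hCd : (C : Set (Finset (Fin n))).Sized d)
    (hclique : ∀ W : Finset (Fin n), W.card = d + 1 → ¬ Finset.powersetCard d W ⊆ C) :
    HasLinearResolution (circuitIdeal K d C) d ↔ IsCycleFree K C := by
  refine ⟨fun h => h.koszulAcyclicAbove.isCycleFree hd hCd hclique, fun h =>
    hasLinearResolution_of_koszulAcyclicAbove (fun P p hp => ?_) (fun p hp β hβ => ?_)
      (koszulAcyclicAbove_of_isCycleFree h hclique)⟩
  · rw [mem_circuitIdeal_iff hclique] at hp ⊢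
    exact fun β hβ => hp β (mem_support_filterMonomials.mp hβ).2
  · have h1 := (mem_circuitIdeal_iff hclique).mp hp β hβ
    have h2 : β.support.card ≤ β.degree := by
      rw [Finsupp.degree_apply, Finset.card_eq_sum_ones]
      exact Finset.sum_le_sum fun v hv =>
        Nat.one_le_iff_ne_zero.mpr (Finsupp.mem_support_iff.mp hv)
    omega

/-- Subclutters inherit the absence of `(d + 1)`-cliques, so the cycle criterion applies to all of
them; the proper ones are always cycle-free, and only `C` itself remains in question. -/
theorem IsPseudoManifold.isMinimalToLinearity_iff (hd : 1 ≤ d) (hne : C.Nonempty)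
    (hC : IsPseudoManifold d C)
    (hsimplex : ∀ W : Finset (Fin n), W.card = d + 1 → C ≠ Finset.powersetCard d W) :
    IsMinimalToLinearity K d C ↔ ¬ IsCycleFree K C := by
  have hclique := hC.not_powersetCard_subset hsimplex
  rw [IsMinimalToLinearity, IsObstructionToLinearity,
    hasLinearResolution_circuitIdeal_iff hd hC.1 hclique]
  refine ⟨fun h => h.1.1, fun h => ⟨⟨h, fun C' hC' => ?_⟩,
    complexDim_cliqueComplex hne hC.1 hclique⟩⟩
  exact (hasLinearResolution_circuitIdeal_iff hd
    (hC.1.mono (Finset.coe_subset.mpr hC'.1))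
    fun W hW hsub => hclique W hW (hsub.trans hC'.1)).mpr (hC.isCycleFree_of_ssubset hC')

end Linearity

theorem mainTheorem6 (K : Type*) [Field K] (n d : ℕ) (hd : 1 ≤ d)
    (C : Finset (Finset (Fin n))) (hne : C.Nonempty) (hC : IsPseudoManifold d C)
    (hsimplex : ∀ W : Finset (Fin n), W.card = d + 1 → C ≠ Finset.powersetCard d W) :
    (IsOrientable C → IsMinimalToLinearity K d C) ∧
    (¬ IsOrientable C → (IsMinimalToLinearity K d C ↔ CharP K 2)) := by
  rw [hC.isMinimalToLinearity_iff hd hne hsimplex]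
  refine ⟨hC.not_isCycleFree_of_isOrientable hne, fun hor => ⟨fun h => ?_, fun h => ?_⟩⟩
  · refine CharTwo.of_one_ne_zero_of_two_eq_zero one_ne_zero ?_
    by_contra h2
    exact hor (hC.isOrientable_of_not_isCycleFree h2 h)
  · exact hC.not_isCycleFree_of_charTwo hne
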